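/- Let $\mathbb S\subset\mathbb C$ be the open left half-plane (continuous time) or the open unit disk (discrete time). All matrices of rational functions below have entries in $\mathbb R(\lambda)$. The finite poles and zeros of such a matrix $\mathbf G(\lambda)$, with their degrees (total multiplicities), are the roots of $\prod_k\psi_k$ and of $\prod_k\varepsilon_k$, where $\mathrm{diag}(\varepsilon_1/\psi_1,\dots,\varepsilon_r/\psi_r,0,\dots,0)$ is the Smith–McMillan form of $\mathbf G$; the pole or zero of $\mathbf G(\lambda)$ at $\infty$ is that of $\mathbf G(1/\lambda)$ at $0$. The McMillan degree of $\mathbf G$ is the sum of the degrees of its poles in $\mathbb C\cup\{\infty\}$; $\mathbf G$ is proper if it has no pole at $\infty$, and stable if it has no pole in $(\mathbb C\cup\{\infty\})\setminus\mathbb S$. Let $p\le n$, $A\in\mathbb R^{n\times n}$, $B\in\mathbb R^{n\times m}$, $C=[\,I_p\ \ O\,]\in\mathbb R^{p\times n}$, and let $\mathbf G(\lambda)=C(\lambda I_n-A)^{-1}B$. Suppose that this realization is minimal: no state-space realization $D'+C'(\lambda I_k-A')^{-1}B'$ of $\mathbf G$ has order $k<n$. Let $(\mathbf W,\mathbf V)$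 be a stable System Response-Type Realization (SRTR) of this system, that is, $\mathbf W$ ($p\times p$) and $\mathbf V$ ($p\times m$) are proper, $[\,\mathbf W\ \ \mathbf V\,]$ has McMillan degree at most $n-p$ and is stable, and $\mathbf G(\lambda)=(\lambda I_p-\mathbf W(\lambda))^{-1}\mathbf V(\lambda)$. Let $A_x,B_x,C_x\in\mathbb R^{p\times p}$, where all eigenvalues of $A_x$ lie in $\mathbb S$ and $B_x$, $C_x$ are invertible, and put $$\mathbf\Theta(\lambda)=C_x(\lambda I_p-A_x)^{-1}B_x,\qquad [\,\mathbf M(\lambda)\ \ \mathbf N(\lambda)\,]=\mathbf\Theta(\lambda)\,[\,\lambda I_p-\mathbf W(\lambda)\ \ \mathbf V(\lambda)\,].$$ Then: (a) $(\mathbf M,\mathbf N)$ is a left coprime factorization of $\mathbf G$ over $\mathbb S$: $\mathbf M$ is invertible over $\mathbb R(\lambda)$, $\mathbf G=\mathbf M^{-1}\mathbf N$, and $[\,\mathbf M\ \ \mathbf N\,]$ has full row normal rank and neither poles nor zeros in $(\mathbb C\cup\{\infty\})\setminus\mathbb S$. (b) The poles of the SRTR pair are preserved, with their degrees: for every $z\in\mathbb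 C\cup\{\infty\}$, the degree of $z$ as a pole of $[\,\mathbf W\ \ \mathbf V\,]$, of $\mathbf W$ and of $\mathbf V$ is at most its degree as a pole of $[\,\mathbf M\ \ \mathbf N\,]$, of $\mathbf M$ and of $\mathbf N$, respectively (the degree being $0$ at points that are not poles). -/

import Mathlib

open Polynomial

/-! ### Smith normal form over `ℝ[X]` -/

section Smith

variable {ι κ : Type*} [Fintype ι] [Fintype κ] [DecidableEq ι] [DecidableEq κ]

/-- Two polynomial matrices are equivalent if they differ by unimodular factors on both sides. -/
def PolyEquiv (N N' : Matrix ι κ ℝ[X]) : Prop :=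
  ∃ (U : Matrix ι ι ℝ[X]) (V : Matrix κ κ ℝ[X]), IsUnit U ∧ IsUnit V ∧ N = U * N' * V

theorem PolyEquiv.refl (N : Matrix ι κ ℝ[X]) : PolyEquiv N N :=
  ⟨1, 1, isUnit_one, isUnit_one, by simp⟩

theorem PolyEquiv.symm {N N' : Matrix ι κ ℝ[X]} (h : PolyEquiv N N') : PolyEquiv N' N := by
  obtain ⟨U, V, hU, hV, rfl⟩ := h
  obtain ⟨U, rfl⟩ := hU
  obtain ⟨V, rfl⟩ := hV
  refine ⟨(U⁻¹ : (Matrix ι ι ℝ[X])ˣ), (V⁻¹ : (Matrix κ κ ℝ[X])ˣ), Units.isUnit _,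
    Units.isUnit _, ?_⟩
  simp only [Matrix.mul_assoc, Units.mul_inv, Matrix.mul_one]
  rw [← Matrix.mul_assoc, Units.inv_mul, Matrix.one_mul]

theorem PolyEquiv.trans {N N' N'' : Matrix ι κ ℝ[X]} (h : PolyEquiv N N')
    (h' : PolyEquiv N' N'') : PolyEquiv N N'' := by
  obtain ⟨U, V, hU, hV, rfl⟩ := h
  obtain ⟨U', V', hU', hV', rfl⟩ := h'
  exact ⟨U * U', V' * V, hU.mul hU', hV'.mul hV, by simp only [Matrix.mul_assoc]⟩

theorem PolyEquiv.transpose {N N' : Matrix ι κ ℝ[X]} (h : PolyEquiv N N') :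
    PolyEquiv N.transpose N'.transpose := by
  obtain ⟨U, V, hU, hV, rfl⟩ := h
  refine ⟨V.transpose, U.transpose, ?_, ?_, ?_⟩
  · rw [Matrix.isUnit_iff_isUnit_det] at hV ⊢
    rwa [Matrix.det_transpose]
  · rw [Matrix.isUnit_iff_isUnit_det] at hU ⊢
    rwa [Matrix.det_transpose]
  · simp [Matrix.transpose_mul, Matrix.mul_assoc]

/-- Adding multiples of column `j₀` to the other columns. -/
theorem polyEquiv_addCols (N : Matrix ι κ ℝ[X]) (j₀ : κ) (c : κ → ℝ[X]) (hc : c j₀ = 0) :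
    PolyEquiv (Matrix.of fun i j => N i j + N i j₀ * c j) N := by
  set E : Matrix κ κ ℝ[X] := Matrix.of fun k j => if k = j₀ then c j else 0 with hE
  have hEE : E * E = 0 := by
    ext k j : 1
    rw [Matrix.mul_apply, Matrix.zero_apply]
    refine Finset.sum_eq_zero fun l _ => ?_
    by_cases hl : l = j₀
    · subst hl; simp [hE, hc]
    · simp [hE, hl]
  refine ⟨1, 1 + E, isUnit_one, ?_, ?_⟩
  · refine IsUnit.of_mul_eq_one (1 - E) ?_
    have : (1 + E) * (1 - E) = 1 - E * E := by noncomm_ring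
    rw [this, hEE, sub_zero]
  · ext i j : 1
    rw [Matrix.one_mul, Matrix.mul_add, Matrix.mul_one, Matrix.add_apply, Matrix.mul_apply]
    simp [hE]

theorem polyEquiv_addRows (N : Matrix ι κ ℝ[X]) (i₀ : ι) (c : ι → ℝ[X]) (hc : c i₀ = 0) :
    PolyEquiv (Matrix.of fun i j => N i j + N i₀ j * c i) N :=
  (polyEquiv_addCols N.transpose i₀ c hc).transpose

/-- An entry of least degree among all nonzero entries of all equivalent matrices divides
its row. -/
theorem dvd_of_minimal {N M : Matrix ι κ ℝ[X]} {i₀ : ι} {j₀ : κ} (hM : PolyEquiv M N)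
    (ha : M i₀ j₀ ≠ 0)
    (hmin : ∀ M' : Matrix ι κ ℝ[X], PolyEquiv M' N → ∀ i j, M' i j ≠ 0 →
      (M i₀ j₀).degree ≤ (M' i j).degree) (j : κ) : M i₀ j₀ ∣ M i₀ j := by
  by_cases hj : j = j₀
  · subst hj; exact dvd_rfl
  by_contra hnd
  have hmod : M i₀ j % M i₀ j₀ ≠ 0 := fun h => hnd (EuclideanDomain.mod_eq_zero.mp h)
  set c : κ → ℝ[X] := fun k => if k = j₀ then 0 else -(M i₀ k / M i₀ j₀) with hc
  have h1 := (polyEquiv_addCols M j₀ c (by simp [hc])).trans hM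
  have hval : M i₀ j + M i₀ j₀ * c j = M i₀ j % M i₀ j₀ := by
    have := EuclideanDomain.div_add_mod (M i₀ j) (M i₀ j₀)
    simp only [hc, hj, if_false]
    linear_combination -this
  have h2 := hmin _ h1 i₀ j (by simpa [Matrix.of_apply, hval] using hmod)
  simp only [Matrix.of_apply, hval] at h2
  exact absurd (EuclideanDomain.mod_lt (M i₀ j) ha) (not_lt.mpr h2)

/-- The pivot step of the Smith algorithm. -/
theorem exists_pivot (N : Matrix ι κ ℝ[X]) (hN : N ≠ 0) :
    ∃ (M : Matrix ι κ ℝ[X]) (i₀ : ι) (j₀ : κ), PolyEquiv M N ∧ M i₀ j₀ ≠ 0 ∧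
      (∀ i, i ≠ i₀ → M i j₀ = 0) ∧ (∀ j, j ≠ j₀ → M i₀ j = 0) ∧
      ∀ i j, M i₀ j₀ ∣ M i j := by
  classical
  let P : ℕ → Prop := fun d => ∃ (M : Matrix ι κ ℝ[X]) (i : ι) (j : κ),
    PolyEquiv M N ∧ M i j ≠ 0 ∧ (M i j).natDegree = d
  have hP : ∃ d, P d := by
    obtain ⟨i, j, hij⟩ : ∃ i j, N i j ≠ 0 := by
      by_contra! h
      exact hN (by ext i j : 1; simpa using h i j)
    exact ⟨_, N, i, j, PolyEquiv.refl N, hij, rfl⟩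
  obtain ⟨M, i₀, j₀, hMN, ha, hd⟩ := Nat.find_spec hP
  have key : ∀ M₁ : Matrix ι κ ℝ[X], PolyEquiv M₁ N → M₁ i₀ j₀ = M i₀ j₀ →
      ∀ M' : Matrix ι κ ℝ[X], PolyEquiv M' N → ∀ i j, M' i j ≠ 0 →
      (M₁ i₀ j₀).degree ≤ (M' i j).degree := by
    intro M₁ _ h1 M' hM' i j hij
    rw [h1, Polynomial.degree_eq_natDegree ha, Polynomial.degree_eq_natDegree hij, hd]
    exact_mod_cast Nat.find_min' hP ⟨M', i, j, hM', hij, rfl⟩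
  have rowdvd : ∀ M₁ : Matrix ι κ ℝ[X], PolyEquiv M₁ N → M₁ i₀ j₀ = M i₀ j₀ →
      ∀ j, M i₀ j₀ ∣ M₁ i₀ j := by
    intro M₁ hM₁ h1 j
    have := dvd_of_minimal hM₁ (by rwa [h1]) (key M₁ hM₁ h1) j
    rwa [h1] at this
  have coldvd : ∀ M₁ : Matrix ι κ ℝ[X], PolyEquiv M₁ N → M₁ i₀ j₀ = M i₀ j₀ →
      ∀ i, M i₀ j₀ ∣ M₁ i j₀ := by
    intro M₁ hM₁ h1 i
    have := dvd_of_minimal (N := N.transpose) (M := M₁.transpose) (i₀ := j₀) (j₀ := i₀)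
      hM₁.transpose (by simpa [h1] using ha)
      (fun M' hM' a b hab => by
        have := key M₁ hM₁ h1 M'.transpose (by simpa using hM'.transpose) b a (by simpa using hab)
        simpa using this) i
    simpa [h1] using this
  choose q hq using rowdvd M hMN rfl
  have e1 := polyEquiv_addCols M j₀ (fun j => if j = j₀ then 0 else -q j) (by simp)
  set M₁ : Matrix ι κ ℝ[X] :=
    Matrix.of fun i j => M i j + M i j₀ * (if j = j₀ then 0 else -q j) with hM₁
  have hM₁N := e1.trans hMN
  have h1a : M₁ i₀ j₀ = M i₀ j₀ := by simp [hM₁]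
  have h1r : ∀ j, j ≠ j₀ → M₁ i₀ j = 0 := by
    intro j hj
    simp only [hM₁, Matrix.of_apply, hj, if_false]
    linear_combination hq j
  choose s hs using coldvd M₁ hM₁N h1a
  have e2 := polyEquiv_addRows M₁ i₀ (fun i => if i = i₀ then 0 else -s i) (by simp)
  set M₂ : Matrix ι κ ℝ[X] :=
    Matrix.of fun i j => M₁ i j + M₁ i₀ j * (if i = i₀ then 0 else -s i) with hM₂
  have hM₂N := e2.trans hM₁N
  have h2a : M₂ i₀ j₀ = M i₀ j₀ := by simp [hM₂, h1a]
  have h2r : ∀ j, j ≠ j₀ → M₂ i₀ j = 0 := by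
    intro j hj
    simp [hM₂, h1r j hj]
  have h2c : ∀ i, i ≠ i₀ → M₂ i j₀ = 0 := by
    intro i hi
    simp only [hM₂, Matrix.of_apply, hi, if_false, h1a]
    linear_combination hs i
  refine ⟨M₂, i₀, j₀, hM₂N, by rwa [h2a], h2c, h2r, ?_⟩
  intro i j
  by_cases hi : i = i₀
  · subst hi
    by_cases hj : j = j₀
    · subst hj; exact dvd_rfl
    · rw [h2r j hj]; exact dvd_zero _
  by_cases hj : j = j₀
  · subst hj; rw [h2c i hi]; exact dvd_zero _
  have e3 := polyEquiv_addRows M₂ i (fun k => if k = i₀ then 1 else 0) (by simp [hi])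
  have h3 := rowdvd _ (e3.trans hM₂N) (by simp [h2a, h2c i hi]) j
  simpa [h2a, h2r j hj] using h3

/-- Existence of the Smith normal form, with its divisibility chain. -/
theorem exists_smith (n : ℕ) : ∀ {ι κ : Type*} [Fintype ι] [Fintype κ] [DecidableEq ι]
    [DecidableEq κ] (N : Matrix ι κ ℝ[X]), Fintype.card ι = n →
    ∃ (r : ℕ) (row : Fin r ↪ ι) (col : Fin r ↪ κ) (d : Fin r → ℝ[X]),
      (∀ k, d k ≠ 0) ∧ (∀ k l, k ≤ l → d k ∣ d l) ∧
      PolyEquiv N (∑ k, Matrix.single (row k) (col k) (d k)) := by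
  induction n with
  | zero =>
    intro ι κ _ _ _ _ N hcard
    have : IsEmpty ι := Fintype.card_eq_zero_iff.mp hcard
    refine ⟨0, Function.Embedding.ofIsEmpty, Function.Embedding.ofIsEmpty, Fin.elim0,
      fun k => k.elim0, fun k => k.elim0, ?_⟩
    convert PolyEquiv.refl N
    ext i
    exact isEmptyElim i
  | succ n ih =>
    intro ι κ _ _ _ _ N hcard
    by_cases hN : N = 0
    · refine ⟨0, Function.Embedding.ofIsEmpty, Function.Embedding.ofIsEmpty, Fin.elim0,
        fun k => k.elim0, fun k => k.elim0, ?_⟩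
      convert PolyEquiv.refl N
      simp [hN]
    obtain ⟨M, i₀, j₀, hMN, ha, hcol, hrow, hdvd⟩ := exists_pivot N hN
    set a := M i₀ j₀ with ha_def
    choose Q hQ using hdvd
    let N' : Matrix {i // ¬ i = i₀} {j // ¬ j = j₀} ℝ[X] := Matrix.of fun i j => Q i j
    have hcard' : Fintype.card {i // ¬ i = i₀} = n := by
      rw [Fintype.card_subtype_compl, hcard]; simp
    obtain ⟨r, row, col, d, hd0, hdd, U, V, hU, hV, hUV⟩ := ih N' hcard'
    have hS : PolyEquiv M (Matrix.single i₀ j₀ a +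
        ∑ k, Matrix.single (row k : ι) (col k : κ) (a * d k)) := by
      let e := Equiv.sumCompl (fun i : ι => i = i₀)
      let f := Equiv.sumCompl (fun j : κ => j = j₀)
      let S := ∑ k, Matrix.single (row k) (col k) (d k)
      let P : Matrix {i // i = i₀} {j // j = j₀} ℝ[X] := Matrix.of fun _ _ => a
      have hblock : Matrix.fromBlocks P 0 0 (a • N') =
          (Matrix.fromBlocks 1 0 0 U : Matrix ({i // i = i₀} ⊕ _) ({i // i = i₀} ⊕ _) ℝ[X]) *
            Matrix.fromBlocks P 0 0 (a • S) *
            (Matrix.fromBlocks 1 0 0 V : Matrix ({j // j = j₀} ⊕ _) ({j // j = j₀} ⊕ _) ℝ[X]) := by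
        rw [Matrix.fromBlocks_multiply, Matrix.fromBlocks_multiply]
        simp [hUV, S]
      have hMe : M = (Matrix.fromBlocks P 0 0 (a • N')).submatrix e.symm f.symm := by
        ext i j : 1
        obtain ⟨i, rfl⟩ := e.surjective i
        obtain ⟨j, rfl⟩ := f.surjective j
        rw [Matrix.submatrix_apply, Equiv.symm_apply_apply, Equiv.symm_apply_apply]
        rcases i with ⟨i, hi⟩ | ⟨i, hi⟩ <;> rcases j with ⟨j, hj⟩ | ⟨j, hj⟩
        · subst hi; subst hj; simp [e, f, P, a]
        · subst hi; simp [e, f, hrow j hj]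
        · subst hj; simp [e, f, hcol i hi]
        · simp [e, f, N', hQ i j]
      have hSe : (Matrix.single i₀ j₀ a +
          ∑ k, Matrix.single (row k : ι) (col k : κ) (a * d k)) =
          (Matrix.fromBlocks P 0 0 (a • S)).submatrix e.symm f.symm := by
        ext i j : 1
        obtain ⟨i, rfl⟩ := e.surjective i
        obtain ⟨j, rfl⟩ := f.surjective j
        rw [Matrix.submatrix_apply, Equiv.symm_apply_apply, Equiv.symm_apply_apply]
        rcases i with ⟨i, hi⟩ | ⟨i, hi⟩ <;> rcases j with ⟨j, hj⟩ | ⟨j, hj⟩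
        · subst hi; subst hj
          simp [e, f, P, Matrix.sum_apply, (row _).2]
        · subst hi
          simp [e, f, P, Matrix.sum_apply, (row _).2, Ne.symm hj]
        · subst hj
          simp [e, f, P, Matrix.sum_apply, (col _).2, Ne.symm hi]
        · simp [e, f, S, Matrix.sum_apply, Matrix.single_apply, Ne.symm hi, Ne.symm hj,
            Finset.mul_sum, Subtype.ext_iff]
      refine ⟨(Matrix.fromBlocks 1 0 0 U).submatrix e.symm e.symm,
        (Matrix.fromBlocks 1 0 0 V).submatrix f.symm f.symm, ?_, ?_, ?_⟩
      · rw [Matrix.isUnit_submatrix_equiv, Matrix.isUnit_iff_isUnit_det,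
          Matrix.det_fromBlocks_zero₁₂, Matrix.det_one, one_mul,
          ← Matrix.isUnit_iff_isUnit_det]
        exact hU
      · rw [Matrix.isUnit_submatrix_equiv, Matrix.isUnit_iff_isUnit_det,
          Matrix.det_fromBlocks_zero₁₂, Matrix.det_one, one_mul,
          ← Matrix.isUnit_iff_isUnit_det]
        exact hV
      · rw [hSe, Matrix.submatrix_mul_equiv, Matrix.submatrix_mul_equiv, ← hblock, ← hMe]
    refine ⟨r + 1, ⟨Fin.cons i₀ fun k => (row k : ι), ?_⟩, ⟨Fin.cons j₀ fun k => (col k : κ), ?_⟩,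
      Fin.cons a fun k => a * d k, ?_, ?_, ?_⟩
    · rw [Fin.cons_injective_iff]
      refine ⟨?_, Subtype.val_injective.comp row.injective⟩
      rintro ⟨k, hk⟩
      exact (row k).2 hk
    · rw [Fin.cons_injective_iff]
      refine ⟨?_, Subtype.val_injective.comp col.injective⟩
      rintro ⟨k, hk⟩
      exact (col k).2 hk
    · intro k
      refine Fin.cases ?_ (fun k => ?_) k
      · simpa using ha
      · simpa using ⟨ha, hd0 k⟩
    · intro k l
      refine Fin.cases ?_ (fun k => ?_) k <;> refine Fin.cases ?_ (fun l => ?_) l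
      · simp
      · simp
      · intro h; simp at h
      · intro h
        simpa using mul_dvd_mul_left a (hdd k l (by simpa using h))
    · rw [Fin.sum_univ_succ]
      simpa using hMN.symm.trans hS

end Smith

section SmithMcMillan

variable {ι κ : Type*} [Fintype ι] [Fintype κ] [DecidableEq ι] [DecidableEq κ]

/-- A Smith–McMillan form of a matrix `G` of real-rational functions: a factorization
`G = U · diag(ε₁/ψ₁, …, ε_r/ψ_r, 0, …, 0) · V` with `U`, `V` unimodular over `ℝ[λ]`, every fraction
`ε_k/ψ_k` in lowest terms, `ε_k ∣ ε_{k+1}` and `ψ_{k+1} ∣ ψ_k`. The order in which rows and columns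
carry the diagonal entries is recorded by `row` and `col`; the polynomials are normalized only up
to nonzero constants. -/
structure SmithMcMillanForm (G : Matrix ι κ (RatFunc ℝ)) where
  rk : ℕ
  row : Fin rk ↪ ι
  col : Fin rk ↪ κ
  num : Fin rk → ℝ[X]
  den : Fin rk → ℝ[X]
  num_ne_zero : ∀ k, num k ≠ 0
  den_ne_zero : ∀ k, den k ≠ 0
  coprime : ∀ k, IsCoprime (num k) (den k)
  num_dvd : ∀ k l, k ≤ l → num k ∣ num l
  den_dvd : ∀ k l, k ≤ l → den l ∣ den k
  U : Matrix ι ι ℝ[X]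
  V : Matrix κ κ ℝ[X]
  isUnit_U : IsUnit U
  isUnit_V : IsUnit V
  eq : G = U.map (algebraMap ℝ[X] (RatFunc ℝ)) *
    (∑ k, Matrix.single (row k) (col k)
      (algebraMap ℝ[X] (RatFunc ℝ) (num k) / algebraMap ℝ[X] (RatFunc ℝ) (den k))) *
    V.map (algebraMap ℝ[X] (RatFunc ℝ))

theorem ratFunc_num_den_dvd {x y : RatFunc ℝ} (e : ℝ[X])
    (h : y = x * algebraMap ℝ[X] (RatFunc ℝ) e) : x.num ∣ y.num ∧ y.denom ∣ x.denom := by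
  have key : y.num * x.denom = x.num * e * y.denom := by
    have hinj := IsFractionRing.injective ℝ[X] (RatFunc ℝ)
    apply hinj
    have h1 := RatFunc.num_div_denom x
    have h2 := RatFunc.num_div_denom y
    have hxd : algebraMap ℝ[X] (RatFunc ℝ) x.denom ≠ 0 :=
      RatFunc.algebraMap_ne_zero x.denom_ne_zero
    have hyd : algebraMap ℝ[X] (RatFunc ℝ) y.denom ≠ 0 :=
      RatFunc.algebraMap_ne_zero y.denom_ne_zero
    rw [← h1, ← h2] at h
    simp only [map_mul]
    field_simp at h
    linear_combination h
  constructor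
  · refine (RatFunc.isCoprime_num_denom x).dvd_of_dvd_mul_right ?_
    rw [key]
    exact ⟨e * y.denom, by ring⟩
  · refine (RatFunc.isCoprime_num_denom y).symm.dvd_of_dvd_mul_left ?_
    rw [key]
    exact ⟨x.num * e, by ring⟩

instance (G : Matrix ι κ (RatFunc ℝ)) : Nonempty (SmithMcMillanForm G) := by
  let φ := algebraMap ℝ[X] (RatFunc ℝ)
  obtain ⟨b, hb⟩ := IsLocalization.exist_integer_multiples (nonZeroDivisors ℝ[X])
    (Finset.univ : Finset (ι × κ)) (fun x => G x.1 x.2)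
  choose N hN using fun i j => hb (i, j) (Finset.mem_univ _)
  have hb0 : (b : ℝ[X]) ≠ 0 := nonZeroDivisors.ne_zero b.2
  have hφb : φ b ≠ 0 := RatFunc.algebraMap_ne_zero hb0
  obtain ⟨r, row, col, d, hd0, hdd, U, V, hU, hV, hUV⟩ :=
    exists_smith _ (Matrix.of N) rfl
  have hφd : ∀ k, φ (d k) ≠ 0 := fun k => RatFunc.algebraMap_ne_zero (hd0 k)
  let x : Fin r → RatFunc ℝ := fun k => φ (d k) / φ b
  have hx0 : ∀ k, x k ≠ 0 := fun k => div_ne_zero (hφd k) hφb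
  have hxdvd : ∀ k l, k ≤ l → (x k).num ∣ (x l).num ∧ (x l).denom ∣ (x k).denom := by
    intro k l hkl
    obtain ⟨e, he⟩ := hdd k l hkl
    refine ratFunc_num_den_dvd e ?_
    simp only [x, he, map_mul, φ]
    ring
  refine ⟨{ rk := r, row := row, col := col, num := fun k => (x k).num,
            den := fun k => (x k).denom, num_ne_zero := fun k => RatFunc.num_ne_zero (hx0 k),
            den_ne_zero := fun k => (x k).denom_ne_zero,
            coprime := fun k => RatFunc.isCoprime_num_denom _,
            num_dvd := fun k l h => (hxdvd k l h).1, den_dvd := fun k l h => (hxdvd k l h).2,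
            U := U, V := V, isUnit_U := hU, isUnit_V := hV, eq := ?_ }⟩
  have hG : φ b • G = (Matrix.of N).map φ := by
    ext i j : 1
    have := hN i j
    simp only [Algebra.smul_def] at this
    simpa using this.symm
  have hsum : (∑ k, Matrix.single (row k) (col k) (d k)).map φ =
      φ b • ∑ k, Matrix.single (row k) (col k) (φ (x k).num / φ (x k).denom) := by
    ext i j : 1
    simp only [φ, RatFunc.num_div_denom, Matrix.map_apply, Matrix.sum_apply, Matrix.smul_apply,
      map_sum, Matrix.single_apply, smul_eq_mul, Finset.mul_sum]
    refine Finset.sum_congr rfl fun k _ => ?_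
    split_ifs
    · simp only [x]; exact (mul_div_cancel₀ _ hφb).symm
    · simp
  have h2 : φ b • G = φ b • (U.map φ *
      (∑ k, Matrix.single (row k) (col k) (φ (x k).num / φ (x k).denom)) * V.map φ) := by
    rw [hG, hUV, Matrix.map_mul, Matrix.map_mul, hsum]
    simp
  exact smul_right_injective _ hφb h2

/-- A Smith–McMillan form of `G`. The quantities below do not depend on which one is chosen. -/
noncomputable def smithMcMillan (G : Matrix ι κ (RatFunc ℝ)) : SmithMcMillanForm G :=
  Classical.choice inferInstance

/-- The product of the denominators `ψ_k` of the Smith–McMillan form. -/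
noncomputable def polePolynomial (G : Matrix ι κ (RatFunc ℝ)) : ℝ[X] :=
  ∏ k, (smithMcMillan G).den k

/-- The product of the numerators `ε_k` of the Smith–McMillan form. -/
noncomputable def zeroPolynomial (G : Matrix ι κ (RatFunc ℝ)) : ℝ[X] :=
  ∏ k, (smithMcMillan G).num k

/-- The matrix `G(1/λ)`. -/
noncomputable def atInverse (G : Matrix ι κ (RatFunc ℝ)) : Matrix ι κ (RatFunc ℝ) :=
  G.map fun f => f.eval RatFunc.C (RatFunc.X)⁻¹

/-- The degree (total multiplicity) of a point of `ℂ ∪ {∞}` as a pole of `G`; it is zero at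
points that are not poles. -/
noncomputable def poleDegree (G : Matrix ι κ (RatFunc ℝ)) (z : OnePoint ℂ) : ℕ :=
  z.elim ((polePolynomial (atInverse G)).rootMultiplicity 0)
    fun w => ((polePolynomial G).map (algebraMap ℝ ℂ)).rootMultiplicity w

/-- The degree (total multiplicity) of a point of `ℂ ∪ {∞}` as a zero of `G`. -/
noncomputable def zeroDegree (G : Matrix ι κ (RatFunc ℝ)) (z : OnePoint ℂ) : ℕ :=
  z.elim ((zeroPolynomial (atInverse G)).rootMultiplicity 0)
    fun w => ((zeroPolynomial G).map (algebraMap ℝ ℂ)).rootMultiplicity w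

def IsPole (G : Matrix ι κ (RatFunc ℝ)) (z : OnePoint ℂ) : Prop := 0 < poleDegree G z

def IsZero (G : Matrix ι κ (RatFunc ℝ)) (z : OnePoint ℂ) : Prop := 0 < zeroDegree G z

/-- Sum of the degrees of all poles, finite and infinite. -/
noncomputable def mcMillanDegree (G : Matrix ι κ (RatFunc ℝ)) : ℕ :=
  ∑ᶠ z : OnePoint ℂ, poleDegree G z

def IsProper (G : Matrix ι κ (RatFunc ℝ)) : Prop := ¬ IsPole G OnePoint.infty

/-- No poles in `(ℂ ∪ {∞}) \ S`. -/
def IsStable (S : Set ℂ) (G : Matrix ι κ (RatFunc ℝ)) : Prop :=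
  ∀ z : OnePoint ℂ, z ∉ ((↑) : ℂ → OnePoint ℂ) '' S → ¬ IsPole G z

end SmithMcMillan

/-! ### State-space realizations -/

section Realizations

/-- The transfer function matrix `D + C (λ I - A)⁻¹ B` of a realization. -/
noncomputable def transferMatrix {σ ι κ : Type*} [Fintype σ] [DecidableEq σ]
    (A : Matrix σ σ ℝ) (B : Matrix σ κ ℝ) (C : Matrix ι σ ℝ) (D : Matrix ι κ ℝ) :
    Matrix ι κ (RatFunc ℝ) :=
  D.map RatFunc.C + C.map RatFunc.C *
    ((RatFunc.X : RatFunc ℝ) • (1 : Matrix σ σ (RatFunc ℝ)) - A.map RatFunc.C)⁻¹ *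
    B.map RatFunc.C

/-- A realization is minimal if no realization of the same transfer function matrix has a
smaller order. -/
def IsMinimalRealization {σ ι κ : Type*} [Fintype σ] [DecidableEq σ]
    (A : Matrix σ σ ℝ) (B : Matrix σ κ ℝ) (C : Matrix ι σ ℝ) (D : Matrix ι κ ℝ) : Prop :=
  ∀ (k : ℕ) (A' : Matrix (Fin k) (Fin k) ℝ) (B' : Matrix (Fin k) κ ℝ) (C' : Matrix ι (Fin k) ℝ)
    (D' : Matrix ι κ ℝ), transferMatrix A' B' C' D' = transferMatrix A B C D →
    Fintype.card σ ≤ k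

variable {p q m : ℕ}

/-- The output matrix `[I_p  O]`. -/
def outputMatrix (p q : ℕ) : Matrix (Fin p) (Fin p ⊕ Fin q) ℝ := Matrix.fromCols 1 0

/-- The transfer function matrix of the system of order `n = p + q` with state matrix `A`, input
matrix `B`, output matrix `[I_p  O]` and no feedthrough. -/
noncomputable def systemTFM (A : Matrix (Fin p ⊕ Fin q) (Fin p ⊕ Fin q) ℝ)
    (B : Matrix (Fin p ⊕ Fin q) (Fin m) ℝ) : Matrix (Fin p) (Fin m) (RatFunc ℝ) :=
  transferMatrix A B (outputMatrix p q) 0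

/-- The matrix `λ I_p - W(λ)`. -/
noncomputable def lambdaSub (W : Matrix (Fin p) (Fin p) (RatFunc ℝ)) :
    Matrix (Fin p) (Fin p) (RatFunc ℝ) :=
  (RatFunc.X : RatFunc ℝ) • (1 : Matrix (Fin p) (Fin p) (RatFunc ℝ)) - W

/-- `(W, V)` is a System Response-Type Realization of the system with state matrix `A`, input
matrix `B` and output matrix `[I_p  O]`, whose order is `n = p + q`. -/
structure IsSRTR (A : Matrix (Fin p ⊕ Fin q) (Fin p ⊕ Fin q) ℝ)
    (B : Matrix (Fin p ⊕ Fin q) (Fin m) ℝ) (W : Matrix (Fin p) (Fin p) (RatFunc ℝ))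
    (V : Matrix (Fin p) (Fin m) (RatFunc ℝ)) : Prop where
  proper_W : IsProper W
  proper_V : IsProper V
  degree_le : mcMillanDegree (Matrix.fromCols W V) ≤ q
  eq : systemTFM A B = (lambdaSub W)⁻¹ * V

/-- `(M, N)` is a left coprime factorization over `S` of `G`. -/
structure IsLCF (S : Set ℂ) (G : Matrix (Fin p) (Fin m) (RatFunc ℝ))
    (M : Matrix (Fin p) (Fin p) (RatFunc ℝ)) (N : Matrix (Fin p) (Fin m) (RatFunc ℝ)) : Prop where
  isUnit_M : IsUnit M
  eq : G = M⁻¹ * N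
  rank_eq : (Matrix.fromCols M N).rank = p
  no_pole : ∀ z : OnePoint ℂ, z ∉ ((↑) : ℂ → OnePoint ℂ) '' S → ¬ IsPole (Matrix.fromCols M N) z
  no_zero : ∀ z : OnePoint ℂ, z ∉ ((↑) : ℂ → OnePoint ℂ) '' S → ¬ IsZero (Matrix.fromCols M N) z

/-- The two kinds of time axis of an LTI system. -/
inductive TimeDomain
  | continuous
  | discrete

/-- The domain of stability: the open left half-plane in continuous time, the open unit disk in
discrete time. -/
def stabilityDomain : TimeDomain → Set ℂ
  | .continuous => {z | z.re < 0}
  | .discrete => {z | ‖z‖ < 1}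

/-- All eigenvalues of the real square matrix `A` lie in `S`. -/
def EigenvaluesIn (S : Set ℂ) (A : Matrix (Fin p) (Fin p) ℝ) : Prop :=
  spectrum ℂ (A.map (algebraMap ℝ ℂ)) ⊆ S

end Realizations

-- The heart of the matter is that `[λI - W V]` has no finite zeros, in the strong form of a
-- polynomial right inverse (`IsSRTR.exists_right_inverse`). Write `[W V] = T⁻¹ [N₁ N₂]` with `T`
-- polynomial and `det T` of degree at most `q = n - p`, and put `P = λT - N₁`. Then `P G = N₂`, and
-- `deg det P ≤ q + p = n` because `W` is proper. If `G = T₀⁻¹ N₀` is left coprime, then `P = Q T₀`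
-- with `Q` polynomial. Minimality gives `deg det T₀ ≥ n`, so `Q` is unimodular, `(P, N₂)` is left
-- coprime as well, and its Bezout identity yields the right inverse.
--
-- The bound `deg det T₀ ≥ n` comes from `exists_realization`: a strictly proper matrix is realized,
-- on the polynomial model of its denominator, with order at most the degree of its pole polynomial.
--
-- For (a), `Θ⁻¹` is a polynomial matrix of degree at most one (`exists_polynomial_inverse`), so `[M
-- N]` inherits a polynomial right inverse, which excludes finite zeros and gives full row rank. At
-- infinity `M = (λΘ)(1 - λ⁻¹W)` is a product of two factors invertible over the proper functions.
-- Absence of poles outside the stability domain is entrywise.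
--
-- For (b), `W = λI - Θ⁻¹M` and `V = Θ⁻¹N`. Polynomial operations of this kind create no finite
-- poles, multiplicities included, because the pole polynomial divides the determinant of every
-- right polynomial denominator (`polePolynomial_dvd_det`). At infinity nothing is left to prove,
-- since `W` and `V` are proper.

local notation "φ" => algebraMap ℝ[X] (RatFunc ℝ)

/-! ### Rational functions regular at a point, and proper rational functions -/

section RationalFunctions

/-- The rational functions without a pole at the complex number `z`. -/
def regularAt (z : ℂ) : Subring (RatFunc ℝ) where
  carrier := {f | ∃ a b : ℝ[X], aeval z b ≠ 0 ∧ f * φ b = φ a}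
  mul_mem' := by
    rintro f g ⟨a, b, hb, h⟩ ⟨c, d, hd, h'⟩
    refine ⟨a * c, b * d, by simpa using ⟨hb, hd⟩, ?_⟩
    rw [map_mul, map_mul, ← h, ← h']
    ring
  one_mem' := ⟨1, 1, by simp, by simp⟩
  add_mem' := by
    rintro f g ⟨a, b, hb, h⟩ ⟨c, d, hd, h'⟩
    refine ⟨a * d + c * b, b * d, by simpa using ⟨hb, hd⟩, ?_⟩
    rw [map_mul, map_add, map_mul, map_mul, ← h, ← h']
    ring
  zero_mem' := ⟨0, 1, by simp, by simp⟩
  neg_mem' := by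
    rintro f ⟨a, b, hb, h⟩
    exact ⟨-a, b, hb, by rw [map_neg, ← h]; ring⟩

theorem algebraMap_mem_regularAt (z : ℂ) (a : ℝ[X]) : φ a ∈ regularAt z :=
  ⟨a, 1, by simp, by simp⟩

theorem C_mem_regularAt (z : ℂ) (c : ℝ) : RatFunc.C c ∈ regularAt z := by
  simpa using algebraMap_mem_regularAt z (Polynomial.C c)

theorem ne_zero_of_aeval_ne_zero {z : ℂ} {b : ℝ[X]} (h : aeval z b ≠ 0) : b ≠ 0 := by
  rintro rfl
  simp at h

theorem inv_algebraMap_mem_regularAt {z : ℂ} {b : ℝ[X]} (h : aeval z b ≠ 0) :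
    (φ b)⁻¹ ∈ regularAt z :=
  ⟨1, b, h, by
    rw [inv_mul_cancel₀ (RatFunc.algebraMap_ne_zero (ne_zero_of_aeval_ne_zero h)), map_one]⟩

/-- If the product of a polynomial and a regular function is `1`, the polynomial does not
vanish. -/
theorem aeval_ne_zero_of_mul_eq {z : ℂ} {a b : ℝ[X]} {f : RatFunc ℝ} (hf : f ∈ regularAt z)
    (h : φ a * f = φ b) (hb : aeval z b ≠ 0) : aeval z a ≠ 0 := by
  obtain ⟨c, d, hd, hfd⟩ := hf
  have h1 : a * c = b * d := by
    apply IsFractionRing.injective ℝ[X] (RatFunc ℝ)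
    rw [map_mul, map_mul, ← hfd, ← h]
    ring
  have h2 := congrArg (aeval z) h1
  rw [map_mul, map_mul] at h2
  exact left_ne_zero_of_mul (h2 ▸ mul_ne_zero hb hd)

theorem aeval_zero_ne_zero_iff {b : ℝ[X]} : aeval (0 : ℂ) b ≠ 0 ↔ b.coeff 0 ≠ 0 := by
  rw [Polynomial.coeff_zero_eq_eval_zero, ← coe_aeval_eq_eval,
    show (0 : ℂ) = algebraMap ℝ ℂ 0 by simp, aeval_algebraMap_apply]
  simp

/-- Clearing the powers of `λ` from `a(1/λ)` reverses the coefficients. This turns regularity at `0`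
after inversion into a comparison of degrees. -/
theorem eval₂_C_X_inv_mul_pow (N : ℕ) (a : ℝ[X]) (h : a.natDegree ≤ N) :
    a.eval₂ RatFunc.C (RatFunc.X)⁻¹ * RatFunc.X ^ N = φ (a.reflect N) := by
  have hX : (RatFunc.X : RatFunc ℝ) ≠ 0 := RatFunc.X_ne_zero
  let := invertibleOfNonzero hX
  have h1 := eval₂_reflect_mul_pow RatFunc.C (RatFunc.X : RatFunc ℝ) N (a.reflect N)
    (natDegree_reflect_le.trans (max_le le_rfl h))
  rw [reflect_reflect, invOf_eq_inv] at h1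
  rw [h1, ← RatFunc.algebraMap_X, ← RatFunc.algebraMap_comp_C, ← Polynomial.hom_eval₂,
    Polynomial.eval₂_C_X]

theorem eval₂_C_X_inv_ne_zero {a : ℝ[X]} (h : a ≠ 0) :
    a.eval₂ RatFunc.C (RatFunc.X : RatFunc ℝ)⁻¹ ≠ 0 := by
  intro h0
  have h1 := eval₂_C_X_inv_mul_pow _ a le_rfl
  rw [h0, zero_mul, eq_comm, map_eq_zero_iff _ (IsFractionRing.injective ℝ[X] (RatFunc ℝ))] at h1
  exact h (by simpa using h1)

/-- The substitution `λ ↦ 1/λ`. -/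
noncomputable def invSubst : RatFunc ℝ →+* RatFunc ℝ :=
  RatFunc.liftRingHom (eval₂RingHom RatFunc.C (RatFunc.X)⁻¹) fun a ha => by
    simpa using eval₂_C_X_inv_ne_zero (nonZeroDivisors.ne_zero ha)

theorem invSubst_apply (f : RatFunc ℝ) : invSubst f = f.eval RatFunc.C (RatFunc.X)⁻¹ := by
  rw [invSubst, RatFunc.liftRingHom_apply]
  rfl

theorem invSubst_algebraMap (a : ℝ[X]) :
    invSubst (φ a) = a.eval₂ RatFunc.C (RatFunc.X)⁻¹ := by
  rw [invSubst_apply, RatFunc.eval_algebraMap, Algebra.algebraMap_self_apply]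

@[simp] theorem invSubst_C (c : ℝ) : invSubst (RatFunc.C c) = RatFunc.C c := by
  rw [← RatFunc.algebraMap_C, invSubst_algebraMap, eval₂_C]
  simp

@[simp] theorem invSubst_X : invSubst RatFunc.X = (RatFunc.X)⁻¹ := by
  rw [← RatFunc.algebraMap_X, invSubst_algebraMap, eval₂_X]
  simp

theorem invSubst_invSubst (f : RatFunc ℝ) : invSubst (invSubst f) = f := by
  have h : invSubst.comp invSubst = RingHom.id (RatFunc ℝ) := by
    refine IsLocalization.ringHom_ext (nonZeroDivisors ℝ[X]) (Polynomial.ringHom_ext ?_ ?_)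
    · intro c; simp
    · simp
  exact congrArg (fun g : RatFunc ℝ →+* RatFunc ℝ => g f) h

theorem atInverse_eq_map {ι κ : Type*} [Fintype ι] [Fintype κ] [DecidableEq ι] [DecidableEq κ]
    (G : Matrix ι κ (RatFunc ℝ)) : atInverse G = G.map invSubst := by
  ext i j : 1
  simp [atInverse, invSubst_apply]

/-- The rational functions without a pole at infinity. -/
noncomputable def properFunctions : Subring (RatFunc ℝ) := (regularAt 0).comap invSubst

theorem C_mem_proper (c : ℝ) : RatFunc.C c ∈ properFunctions := by
  simpa [properFunctions] using C_mem_regularAt 0 c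

theorem X_inv_mem_proper : (RatFunc.X : RatFunc ℝ)⁻¹ ∈ properFunctions := by
  simpa [properFunctions] using algebraMap_mem_regularAt 0 X

/-- A proper rational function is a fraction whose numerator degree is at most its denominator
degree. -/
theorem exists_natDegree_le_of_proper {f : RatFunc ℝ} (hf : f ∈ properFunctions) :
    ∃ a b : ℝ[X], b ≠ 0 ∧ f * φ b = φ a ∧ a.natDegree ≤ b.natDegree := by
  obtain ⟨a, b, hb, h⟩ := hf
  set N := max a.natDegree b.natDegree
  have hb0 := aeval_zero_ne_zero_iff.mp hb
  -- Reflection moves the nonzero constant coefficient of `b` to degree `N`, so the new denominator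
  -- has full degree `N`.
  have hbN : (b.reflect N).coeff N ≠ 0 := by
    rw [coeff_reflect, revAt_le le_rfl]
    simpa using hb0
  refine ⟨a.reflect N, b.reflect N, fun h0 => hbN (by simp [h0]), ?_, ?_⟩
  · have h1 := congrArg invSubst h
    rw [map_mul, invSubst_invSubst, invSubst_algebraMap, invSubst_algebraMap] at h1
    rw [← eval₂_C_X_inv_mul_pow N a (le_max_left _ _), ← h1,
      ← eval₂_C_X_inv_mul_pow N b (le_max_right _ _)]
    ring
  · refine le_trans (natDegree_reflect_le.trans (max_le le_rfl (le_max_left _ _))) ?_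
    exact le_natDegree_of_ne_zero hbN

/-- A polynomial which is strictly proper is zero. -/
theorem eq_zero_of_X_mul_mem_proper {a : ℝ[X]} (h : RatFunc.X * φ a ∈ properFunctions) :
    a = 0 := by
  obtain ⟨c, d, hd, h1, h2⟩ := exists_natDegree_le_of_proper h
  by_contra ha
  have h3 : X * a * d = c := by
    apply IsFractionRing.injective ℝ[X] (RatFunc ℝ)
    rw [map_mul, map_mul, RatFunc.algebraMap_X, h1]
  rw [← h3, natDegree_mul (mul_ne_zero X_ne_zero ha) hd, natDegree_mul X_ne_zero ha,
    natDegree_X] at h2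
  omega

/-- A proper rational function has a value at infinity. -/
theorem exists_value_at_infinity {f : RatFunc ℝ} (hf : f ∈ properFunctions) :
    ∃ c : ℝ, RatFunc.X * (f - RatFunc.C c) ∈ properFunctions := by
  obtain ⟨a, b, hb, h⟩ := hf
  have hb0 := aeval_zero_ne_zero_iff.mp hb
  -- The value of `f(1/λ)` at `0`; subtracting it makes the numerator divisible by `X`.
  set c := a.coeff 0 / b.coeff 0 with hc
  obtain ⟨e, he⟩ : X ∣ a - Polynomial.C c * b := by
    rw [X_dvd_iff]
    simp [hc, hb0]
  refine ⟨c, e, b, hb, ?_⟩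
  have hX : (RatFunc.X : RatFunc ℝ) ≠ 0 := RatFunc.X_ne_zero
  have h1 := congrArg φ he
  rw [map_sub, map_mul, map_mul, RatFunc.algebraMap_C, RatFunc.algebraMap_X, ← h] at h1
  rw [map_mul, map_sub, invSubst_X, invSubst_C]
  field_simp
  linear_combination h1

/-- Such a function has value `1` at infinity: after `λ ↦ 1/λ` it is `(b + X a)/b`, whose numerator
and denominator agree at `0`, where `b` does not vanish. -/
theorem isUnit_one_sub_X_inv_mul (x g : properFunctions)
    (hx : (x : RatFunc ℝ) = (RatFunc.X)⁻¹) : IsUnit (1 + x * g) := by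
  obtain ⟨a, b, hb, h⟩ := g.2
  set u : RatFunc ℝ := ((1 + x * g : properFunctions) : RatFunc ℝ)
  have hXa : aeval (0 : ℂ) (b + X * a) ≠ 0 := by simpa using hb
  have hu : invSubst u * φ b = φ (b + X * a) := by
    simp only [u, Subring.coe_add, Subring.coe_mul, Subring.coe_one, map_add, map_mul, map_one, hx,
      map_inv₀, invSubst_X, inv_inv, ← h, RatFunc.algebraMap_X]
    ring
  have hu0 : u ≠ 0 := by
    intro h0
    rw [h0, map_zero, zero_mul] at hu
    exact RatFunc.algebraMap_ne_zero (ne_zero_of_aeval_ne_zero hXa) hu.symm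
  have hinv : u⁻¹ ∈ properFunctions := by
    refine ⟨b, b + X * a, hXa, ?_⟩
    rw [← hu, map_inv₀, ← mul_assoc, inv_mul_cancel₀ ((_root_.map_ne_zero invSubst).mpr hu0), one_mul]
  exact IsUnit.of_mul_eq_one ⟨u⁻¹, hinv⟩ (Subtype.ext (mul_inv_cancel₀ hu0))

end RationalFunctions

/-! ### Matrices with entries in a subring -/

section Entries

variable {ι κ τ : Type*} [Fintype κ] {R : Type*} [CommRing R] (S : Subring R)

theorem mul_entries_mem {G : Matrix ι κ R} {H : Matrix κ τ R} (hG : ∀ i j, G i j ∈ S)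
    (hH : ∀ i j, H i j ∈ S) (i : ι) (j : τ) : (G * H) i j ∈ S := by
  rw [Matrix.mul_apply]
  exact sum_mem fun k _ => mul_mem (hG i k) (hH k j)

theorem det_mem [DecidableEq κ] {G : Matrix κ κ R} (hG : ∀ i j, G i j ∈ S) : G.det ∈ S := by
  have h : G = (Matrix.of fun i j => (⟨G i j, hG i j⟩ : S)).map S.subtype := by
    ext i j : 1
    simp
  rw [h, ← RingHom.mapMatrix_apply, ← RingHom.map_det]
  exact Subtype.property _

/-- For `W` proper, `1 - λ⁻¹ W` is invertible over the ring of proper functions. -/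
theorem exists_proper_inverse [DecidableEq κ] {W : Matrix κ κ (RatFunc ℝ)}
    (hW : ∀ i j, W i j ∈ properFunctions) :
    ∃ K : Matrix κ κ (RatFunc ℝ), (∀ i j, K i j ∈ properFunctions) ∧
      (1 - (RatFunc.X : RatFunc ℝ)⁻¹ • W) * K = 1 ∧ (1 - (RatFunc.X : RatFunc ℝ)⁻¹ • W).det ≠ 0 ∧
      (1 - (RatFunc.X : RatFunc ℝ)⁻¹ • W).det ∈ properFunctions := by
  set x : properFunctions := ⟨_, X_inv_mem_proper⟩
  set W' : Matrix κ κ properFunctions := Matrix.of fun i j => -⟨W i j, hW i j⟩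
  have hmap : 1 - (RatFunc.X : RatFunc ℝ)⁻¹ • W =
      properFunctions.subtype.mapMatrix (1 + x • W') := by
    ext i j : 1
    simp [x, W', Matrix.one_apply, sub_eq_add_neg, apply_ite]
  have hdet : IsUnit (1 + x • W').det := by
    -- The determinant is `1 + x · tr + x² · (…)`, hence of the form `1 + x g`.
    rw [Matrix.det_one_add_smul]
    convert isUnit_one_sub_X_inv_mul x _ rfl using 1
    rw [add_assoc, mul_comm _ x, pow_two, mul_comm _ (x * x), mul_assoc, ← mul_add]
  have hunit : IsUnit (1 + x • W') := (Matrix.isUnit_iff_isUnit_det _).mpr hdet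
  obtain ⟨K, hK⟩ := hunit.exists_right_inv
  refine ⟨properFunctions.subtype.mapMatrix K, fun i j => (K i j).2, ?_, ?_, ?_⟩
  · rw [hmap, ← map_mul, hK, map_one]
  · rw [hmap, ← RingHom.map_det]
    exact (hdet.map properFunctions.subtype).ne_zero
  · rw [hmap, ← RingHom.map_det]
    exact Subtype.property _

end Entries

/-! ### Coprime factorizations, poles and zeros -/

section Factorizations

theorem map_algebraMap_mul {ι κ τ : Type*} [Fintype ι] (M : Matrix τ ι ℝ[X])
    (N : Matrix ι κ ℝ[X]) :
    (M * N).map φ = M.map φ * N.map φ := Matrix.map_mul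

theorem map_algebraMap_one {ι : Type*} [DecidableEq ι] : (1 : Matrix ι ι ℝ[X]).map φ = 1 :=
  Matrix.map_one _ (map_zero _) (map_one _)

theorem map_algebraMap_injective {κ τ : Type*} {M N : Matrix τ κ ℝ[X]}
    (h : M.map φ = N.map φ) : M = N :=
  Matrix.map_injective (IsFractionRing.injective ℝ[X] (RatFunc ℝ)) h

variable {ι κ : Type*} [Fintype ι] [Fintype κ] [DecidableEq ι] [DecidableEq κ]

theorem det_map_algebraMap (M : Matrix ι ι ℝ[X]) : (M.map φ).det = φ M.det :=
  (RingHom.map_det (algebraMap ℝ[X] (RatFunc ℝ)) M).symm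

/-- The left coprime polynomial factorization `G = (Δ U)⁻¹ N`, with `Δ` diagonal, which is read off
a Smith–McMillan form. -/
theorem SmithMcMillanForm.exists_left_coprime {G : Matrix ι κ (RatFunc ℝ)}
    (F : SmithMcMillanForm G) :
    ∃ (δ : ι → ℝ[X]) (U : Matrix ι ι ℝ[X]) (N : Matrix ι κ ℝ[X]) (Y : Matrix ι ι ℝ[X])
      (Z : Matrix κ ι ℝ[X]), (∀ i, δ i ≠ 0) ∧ ∏ i, δ i = ∏ k, F.den k ∧ IsUnit U ∧
      (Matrix.diagonal δ * U).map φ * G = N.map φ ∧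
      Matrix.diagonal δ * U * Y + N * Z = 1 := by
  choose a b hab using F.coprime
  obtain ⟨U', hU'⟩ := F.isUnit_U.exists_left_inv
  obtain ⟨V', hV'⟩ := F.isUnit_V.exists_right_inv
  have hδ : ∀ k, Function.extend F.row F.den 1 (F.row k) = F.den k :=
    fun k => F.row.injective.extend_apply _ _ k
  have hδ0 : ∀ i, (Function.extend F.row F.den 1) i ≠ 0 := by
    intro i
    by_cases hi : ∃ k, F.row k = i
    · obtain ⟨k, rfl⟩ := hi
      rw [hδ]
      exact F.den_ne_zero k
    · rw [Function.extend_apply' _ _ _ hi]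
      exact one_ne_zero
  -- The Bezout coefficients `a_k ε_k + b_k ψ_k = 1` are assembled along the diagonal. In rows
  -- without a diagonal entry the default `1` for both denominator and coefficient keeps `∏ δ` and
  -- the identity correct.
  refine ⟨Function.extend F.row F.den 1, U',
    (∑ k, Matrix.single (F.row k) (F.col k) (F.num k)) * F.V,
    F.U * Matrix.diagonal (Function.extend F.row b 1),
    V' * ∑ k, Matrix.single (F.col k) (F.row k) (a k), hδ0, ?_, ?_, ?_, ?_⟩
  · rw [← Finset.prod_subset (Finset.subset_univ (Finset.univ.map F.row)), Finset.prod_map]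
    · exact Finset.prod_congr rfl fun k _ => hδ k
    · intro i _ hi
      exact Function.extend_apply' _ _ _ fun ⟨k, hk⟩ => hi (by simp [← hk])
  · exact IsUnit.of_mul_eq_one _ hU'
  · have h1 : (Matrix.diagonal (Function.extend F.row F.den 1)).map φ *
        (∑ k, Matrix.single (F.row k) (F.col k) (φ (F.num k) / φ (F.den k))) =
        (∑ k, Matrix.single (F.row k) (F.col k) (F.num k)).map φ := by
      ext i j : 1
      rw [Matrix.diagonal_map (map_zero _), Matrix.diagonal_mul, Matrix.map_apply,
        Matrix.sum_apply, Matrix.sum_apply, map_sum, Finset.mul_sum]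
      refine Finset.sum_congr rfl fun k _ => ?_
      rw [Matrix.single_apply, Matrix.single_apply]
      split_ifs with h
      · rw [← h.1, hδ,
          mul_div_cancel₀ _ (RatFunc.algebraMap_ne_zero (F.den_ne_zero k))]
      · simp
    refine (congrArg _ F.eq).trans ?_
    rw [map_algebraMap_mul, map_algebraMap_mul, ← h1]
    have h2 : U'.map φ * F.U.map φ = 1 := by
      rw [← map_algebraMap_mul, hU', map_algebraMap_one]
    calc _ = (Matrix.diagonal (Function.extend (⇑F.row) F.den 1)).map φ *
          (U'.map φ * F.U.map φ) *
          (∑ k, Matrix.single (F.row k) (F.col k) (φ (F.num k) / φ (F.den k))) * F.V.map φ := by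
          simp only [Matrix.mul_assoc]
      _ = _ := by rw [h2, Matrix.mul_one]
  · have h1 : Matrix.diagonal (Function.extend F.row F.den 1) * U' *
        (F.U * Matrix.diagonal (Function.extend F.row b 1)) =
        Matrix.diagonal (Function.extend F.row F.den 1) *
          Matrix.diagonal (Function.extend F.row b 1) := by
      rw [Matrix.mul_assoc, ← Matrix.mul_assoc U', hU', Matrix.one_mul]
    have h2 : ((∑ k, Matrix.single (F.row k) (F.col k) (F.num k)) * F.V) *
        (V' * ∑ k, Matrix.single (F.col k) (F.row k) (a k)) =
        ∑ k, Matrix.single (F.row k) (F.row k) (F.num k * a k) := by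
      rw [Matrix.mul_assoc, ← Matrix.mul_assoc F.V, hV', Matrix.one_mul, Matrix.sum_mul]
      refine Finset.sum_congr rfl fun k _ => ?_
      rw [Matrix.mul_sum, Finset.sum_eq_single k]
      · rw [Matrix.single_mul_single_same]
      · intro l _ hl
        exact Matrix.single_mul_single_of_ne _ _ _ _ (fun h => hl (F.col.injective h).symm) _
      · simp
    rw [h1, h2, Matrix.diagonal_mul_diagonal]
    ext i j : 1
    rw [Matrix.add_apply, Matrix.sum_apply]
    by_cases hi : ∃ k, F.row k = i
    · obtain ⟨k, rfl⟩ := hi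
      rw [Finset.sum_eq_single k]
      · by_cases hj : F.row k = j
        · subst hj
          rw [Matrix.diagonal_apply_eq, Matrix.single_apply_same, Matrix.one_apply_eq, hδ,
            F.row.injective.extend_apply, ← hab k]
          ring
        · rw [Matrix.diagonal_apply_ne _ hj, Matrix.one_apply_ne hj, Matrix.single_apply,
            if_neg (fun h => hj h.2), add_zero]
      · intro l _ hl
        rw [Matrix.single_apply, if_neg (fun h => hl (F.row.injective h.1))]
      · simp
    · rw [Finset.sum_eq_zero, add_zero, Matrix.diagonal_apply, Matrix.one_apply,
        Function.extend_apply' _ _ _ hi, Function.extend_apply' _ _ _ hi]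
      · simp
      · intro k _
        rw [Matrix.single_apply, if_neg (fun h => hi ⟨k, h.1⟩)]

/-- The transposed Smith–McMillan form. -/
def SmithMcMillanForm.transpose {G : Matrix ι κ (RatFunc ℝ)} (F : SmithMcMillanForm G) :
    SmithMcMillanForm G.transpose where
  rk := F.rk
  row := F.col
  col := F.row
  num := F.num
  den := F.den
  num_ne_zero := F.num_ne_zero
  den_ne_zero := F.den_ne_zero
  coprime := F.coprime
  num_dvd := F.num_dvd
  den_dvd := F.den_dvd
  U := F.V.transpose
  V := F.U.transpose
  isUnit_U := (Matrix.isUnit_transpose _).mpr F.isUnit_V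
  isUnit_V := (Matrix.isUnit_transpose _).mpr F.isUnit_U
  eq := by
    conv_lhs => rw [F.eq]
    rw [Matrix.transpose_mul, Matrix.transpose_mul, Matrix.transpose_sum, Matrix.transpose_map,
      Matrix.transpose_map, Matrix.mul_assoc]
    simp only [Matrix.transpose_single]

theorem polePolynomial_ne_zero (G : Matrix ι κ (RatFunc ℝ)) : polePolynomial G ≠ 0 :=
  Finset.prod_ne_zero_iff.mpr fun k _ => (smithMcMillan G).den_ne_zero k

theorem exists_left_coprime (G : Matrix ι κ (RatFunc ℝ)) :
    ∃ (T : Matrix ι ι ℝ[X]) (N : Matrix ι κ ℝ[X]) (Y : Matrix ι ι ℝ[X]) (Z : Matrix κ ι ℝ[X]),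
      T.map φ * G = N.map φ ∧ T * Y + N * Z = 1 ∧ Associated T.det (polePolynomial G) := by
  obtain ⟨δ, U, N, Y, Z, -, hδ, hU, hN, hYZ⟩ := (smithMcMillan G).exists_left_coprime
  refine ⟨Matrix.diagonal δ * U, N, Y, Z, hN, hYZ, ?_⟩
  rw [Matrix.det_mul, Matrix.det_diagonal, hδ]
  exact (associated_mul_unit_left _ _ ((Matrix.isUnit_iff_isUnit_det _).mp hU))

/-- The transposed form has the same `ψ_k`, so its left factorization, transposed back, has the pole
polynomial of `G` itself as determinant. No uniqueness of Smith–McMillan forms is needed. -/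
theorem exists_right_coprime (G : Matrix ι κ (RatFunc ℝ)) :
    ∃ (T : Matrix κ κ ℝ[X]) (N : Matrix ι κ ℝ[X]) (Y : Matrix κ κ ℝ[X]) (Z : Matrix κ ι ℝ[X]),
      G * T.map φ = N.map φ ∧ Y * T + Z * N = 1 ∧ Associated T.det (polePolynomial G) := by
  obtain ⟨δ, U, N, Y, Z, -, hδ, hU, hN, hYZ⟩ := (smithMcMillan G).transpose.exists_left_coprime
  refine ⟨(Matrix.diagonal δ * U).transpose, N.transpose, Y.transpose, Z.transpose, ?_, ?_, ?_⟩
  · rw [Matrix.transpose_map, ← G.transpose_transpose, ← Matrix.transpose_mul, hN,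
      Matrix.transpose_map]
  · rw [← Matrix.transpose_mul, ← Matrix.transpose_mul, ← Matrix.transpose_add, hYZ,
      Matrix.transpose_one]
  · rw [Matrix.det_transpose, Matrix.det_mul, Matrix.det_diagonal, hδ]
    exact (associated_mul_unit_left _ _ ((Matrix.isUnit_iff_isUnit_det _).mp hU))

/-- The pole polynomial divides the determinant of every right polynomial denominator. -/
theorem polePolynomial_dvd_det {G : Matrix ι κ (RatFunc ℝ)} {T : Matrix κ κ ℝ[X]}
    {N : Matrix ι κ ℝ[X]} (h : G * T.map φ = N.map φ) :
    polePolynomial G ∣ T.det := by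
  obtain ⟨T₀, N₀, Y, Z, hN₀, hYZ, hdet⟩ := exists_right_coprime G
  have h1 : (Y.map φ + Z.map φ * G) * T₀.map φ = 1 := by
    rw [Matrix.add_mul, Matrix.mul_assoc, hN₀, ← map_algebraMap_mul, ← map_algebraMap_mul,
      ← Matrix.map_add _ (map_add _), hYZ, map_algebraMap_one]
  -- Since `N = G T`, the second factor is `(Y + Z G) T = T₀⁻¹ T`: every right denominator is a
  -- polynomial multiple of the coprime one.
  have h2 : T = T₀ * (Y * T + Z * N) := by
    apply map_algebraMap_injective
    rw [map_algebraMap_mul, Matrix.map_add _ (map_add _), map_algebraMap_mul,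
      map_algebraMap_mul, ← h, ← Matrix.mul_assoc, ← Matrix.add_mul, ← Matrix.mul_assoc,
      mul_eq_one_comm.mp h1, Matrix.one_mul]
  rw [h2, Matrix.det_mul]
  exact hdet.symm.dvd.trans (dvd_mul_right _ _)

/-- Multiplication from the left by a polynomial matrix, multiplication from the right by a
unimodular matrix and addition of a polynomial matrix create no poles. -/
theorem polePolynomial_dvd_of_eq {τ : Type*} [Fintype τ] [DecidableEq τ]
    {G : Matrix ι κ (RatFunc ℝ)} {H : Matrix τ κ (RatFunc ℝ)} {P : Matrix τ ι ℝ[X]}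
    {J : Matrix κ κ ℝ[X]} {E : Matrix τ κ ℝ[X]} (hJ : IsUnit J)
    (h : H * J.map φ = P.map φ * G + E.map φ) : polePolynomial H ∣ polePolynomial G := by
  obtain ⟨T, N, Y, Z, hN, -, hdet⟩ := exists_right_coprime G
  -- A right denominator `T` of `G` gives the right denominator `J T` of `H`, with the same
  -- determinant up to a unit.
  have h1 : H * (J * T).map φ = (P * N + E * T).map φ := by
    rw [map_algebraMap_mul, Matrix.map_add _ (map_add _), map_algebraMap_mul,
      map_algebraMap_mul, ← Matrix.mul_assoc, h, Matrix.add_mul, Matrix.mul_assoc, hN]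
  have hJ' := (Matrix.isUnit_iff_isUnit_det _).mp hJ
  have h2 := polePolynomial_dvd_det h1
  rw [Matrix.det_mul] at h2
  exact ((hJ'.dvd_mul_left).mp h2).trans hdet.dvd

theorem aeval_ne_zero_of_associated {z : ℂ} {a b : ℝ[X]} (h : Associated a b)
    (ha : aeval z a ≠ 0) : aeval z b ≠ 0 := by
  obtain ⟨c, rfl⟩ := h.symm
  rw [map_mul] at ha
  exact left_ne_zero_of_mul ha

/-- The roots of the pole polynomial are the points at which some entry is not regular. -/
theorem aeval_polePolynomial_ne_zero_iff (G : Matrix ι κ (RatFunc ℝ)) (z : ℂ) :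
    aeval z (polePolynomial G) ≠ 0 ↔ ∀ i j, G i j ∈ regularAt z := by
  obtain ⟨T, N, Y, Z, hN, hYZ, hdet⟩ := exists_left_coprime G
  constructor
  · intro hz i j
    have hT := aeval_ne_zero_of_associated hdet.symm hz
    -- Cramer's rule: `adj(T) N = det T · G`.
    refine ⟨(T.adjugate * N) i j, T.det, hT, ?_⟩
    have h1 : (T.adjugate * N).map φ = φ T.det • G := by
      rw [map_algebraMap_mul, ← hN, ← Matrix.mul_assoc, ← map_algebraMap_mul,
        Matrix.adjugate_mul, Matrix.map_smul' _ _ _ (map_mul _), map_algebraMap_one,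
        Matrix.smul_mul, Matrix.one_mul]
    have h2 := congrFun (congrFun h1 i) j
    rw [Matrix.map_apply, Matrix.smul_apply, smul_eq_mul] at h2
    rw [h2, mul_comm]
  · intro hG
    -- By coprimeness `T⁻¹` is regular at `z` whenever `G` is, so `det T` cannot vanish there.
    have h1 : T.map φ * (Y.map φ + G * Z.map φ) = 1 := by
      rw [Matrix.mul_add, ← Matrix.mul_assoc, hN, ← map_algebraMap_mul, ← map_algebraMap_mul,
        ← Matrix.map_add _ (map_add _), hYZ, map_algebraMap_one]
    have h2 : φ T.det * (Y.map φ + G * Z.map φ).det = φ 1 := by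
      rw [← det_map_algebraMap, ← Matrix.det_mul, h1, Matrix.det_one, map_one]
    refine aeval_ne_zero_of_associated hdet (aeval_ne_zero_of_mul_eq ?_ h2 (by simp))
    refine det_mem _ fun i j => add_mem (algebraMap_mem_regularAt z _) ?_
    exact mul_entries_mem _ hG (fun i j => algebraMap_mem_regularAt z _) i j

/-- A matrix with a right inverse that is regular at `z` has no zero at `z`. -/
theorem aeval_zeroPolynomial_ne_zero {G : Matrix ι κ (RatFunc ℝ)} {K : Matrix κ ι (RatFunc ℝ)}
    {z : ℂ} (h : G * K = 1) (hK : ∀ i j, K i j ∈ regularAt z) :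
    aeval z (zeroPolynomial G) ≠ 0 := by
  set F := smithMcMillan G
  set L : Matrix κ ι (RatFunc ℝ) := F.V.map φ * K * F.U.map φ with hL
  set D := ∑ k, Matrix.single (F.row k) (F.col k) (φ (F.num k) / φ (F.den k)) with hD
  have hLreg : ∀ i j, L i j ∈ regularAt z :=
    mul_entries_mem _ (mul_entries_mem _ (fun i j => algebraMap_mem_regularAt z _) hK)
      (fun i j => algebraMap_mem_regularAt z _)
  have hDL : D * L = 1 := by
    rw [hL, ← Matrix.mul_assoc]
    -- With `G = U D V`, `G K = 1` says `U (D V K) = 1`; both factors are square and may be swapped.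
    apply mul_eq_one_comm.mp
    rw [← h]
    conv_rhs => rw [F.eq]
    simp only [Matrix.mul_assoc, hD, F]
  rw [zeroPolynomial, map_prod, Finset.prod_ne_zero_iff]
  intro k _ hk
  -- This entry reads `ε_k · L = ψ_k` with `L` regular at `z`, so a root `z` of `ε_k` would also be
  -- one of `ψ_k`, against coprimality.
  have h1 := congrFun (congrFun hDL (F.row k)) (F.row k)
  rw [Matrix.one_apply_eq, hD, Matrix.sum_mul, Matrix.sum_apply, Finset.sum_eq_single k,
    Matrix.single_mul_apply_same] at h1
  · have hden : φ (F.den k) ≠ 0 := RatFunc.algebraMap_ne_zero (F.den_ne_zero k)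
    have h2 : φ (F.num k) * L (F.col k) (F.row k) = φ (F.den k) := by
      field_simp at h1
      exact h1
    refine aeval_ne_zero_of_mul_eq (hLreg _ _) h2 ?_ hk
    intro hd
    obtain ⟨a, b, hab⟩ := F.coprime k
    have h3 := congrArg (aeval z) hab
    rw [map_add, map_mul, map_mul, hd] at h3
    rw [show aeval z (F.num k) = 0 from hk] at h3
    simp at h3
  · intro l _ hl
    exact Matrix.single_mul_apply_of_ne _ _ _ _ _ (fun h => hl (F.row.injective h.symm)) _
  · simp

end Factorizations

/-! ### Realization of strictly proper rational matrices -/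

section Realization

theorem map_algebraMap_smul {ι κ : Type*} (a : ℝ[X]) (N : Matrix ι κ ℝ[X]) :
    (a • N).map φ = φ a • N.map φ := by
  ext i j : 1
  simp

theorem map_map_C {ι κ : Type*} (A : Matrix ι κ ℝ) :
    (A.map Polynomial.C).map φ = A.map RatFunc.C := by
  ext i j : 1
  simp

variable {σ : Type*} [Fintype σ] [DecidableEq σ]

theorem charmatrix_map_algebraMap (A : Matrix σ σ ℝ) :
    A.charmatrix.map φ = (RatFunc.X : RatFunc ℝ) • 1 - A.map RatFunc.C := by
  ext i j : 1
  simp [Matrix.charmatrix_apply, Matrix.diagonal_apply, Matrix.one_apply, apply_ite φ]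

theorem transferMatrix_zero {ι κ : Type*} (A : Matrix σ σ ℝ) (B : Matrix σ κ ℝ) (C : Matrix ι σ ℝ) :
    transferMatrix A B C 0 =
      C.map RatFunc.C * (A.charmatrix.map φ)⁻¹ * B.map RatFunc.C := by
  rw [transferMatrix, charmatrix_map_algebraMap, Matrix.map_zero _ (map_zero _), zero_add]

theorem isUnit_charmatrix_map (A : Matrix σ σ ℝ) : IsUnit (A.charmatrix.map φ) := by
  rw [Matrix.isUnit_iff_isUnit_det, isUnit_iff_ne_zero, det_map_algebraMap]
  exact RatFunc.algebraMap_ne_zero A.charpoly_monic.ne_zero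

/-- The resolvent `(λ I - A)⁻¹` is `λ⁻¹` times a proper matrix. -/
theorem exists_resolvent_eq (A : Matrix σ σ ℝ) :
    ∃ K : Matrix σ σ (RatFunc ℝ), (∀ i j, K i j ∈ properFunctions) ∧
      (A.charmatrix.map φ)⁻¹ = (RatFunc.X : RatFunc ℝ)⁻¹ • K := by
  obtain ⟨K, hK, h1, -⟩ := exists_proper_inverse (W := A.map RatFunc.C)
    fun i j => C_mem_proper (A i j)
  refine ⟨K, hK, Matrix.inv_eq_right_inv ?_⟩
  rw [Matrix.mul_smul, ← Matrix.smul_mul, ← h1, charmatrix_map_algebraMap, smul_sub, smul_smul,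
    inv_mul_cancel₀ RatFunc.X_ne_zero, one_smul]

theorem transferMatrix_strictly_proper {ι κ : Type*} (A : Matrix σ σ ℝ) (B : Matrix σ κ ℝ) (C : Matrix ι σ ℝ)
    (i : ι) (j : κ) : RatFunc.X * transferMatrix A B C 0 i j ∈ properFunctions := by
  obtain ⟨K, hK, h⟩ := exists_resolvent_eq A
  have h1 : (RatFunc.X : RatFunc ℝ) • transferMatrix A B C 0 =
      C.map RatFunc.C * K * B.map RatFunc.C := by
    rw [transferMatrix_zero, h, Matrix.mul_smul, Matrix.smul_mul, smul_smul,
      mul_inv_cancel₀ RatFunc.X_ne_zero, one_smul]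
  rw [← smul_eq_mul, ← Matrix.smul_apply, h1]
  exact mul_entries_mem _ (mul_entries_mem _ (fun _ _ => C_mem_proper _) hK)
    (fun _ _ => C_mem_proper _) i j

variable {ι κ : Type*} [Fintype ι] [Fintype κ] [DecidableEq ι] [DecidableEq κ]

/-- The polynomial vectors `w` for which `T⁻¹ w` is strictly proper: the state space of the
realization with denominator `T`. -/
noncomputable def polynomialModel (T : Matrix ι ι ℝ[X]) : Submodule ℝ (ι → ℝ[X]) where
  carrier := {w | ∀ i, RatFunc.X * ((T.map φ)⁻¹.mulVec (φ ∘ w)) i ∈ properFunctions}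
  zero_mem' i := by
    have : (φ ∘ (0 : ι → ℝ[X])) = 0 := by ext; simp
    rw [this, Matrix.mulVec_zero]
    simp
  add_mem' {v w} hv hw i := by
    have : (φ ∘ (v + w)) = φ ∘ v + φ ∘ w := by ext; simp
    rw [this, Matrix.mulVec_add, Pi.add_apply, mul_add]
    exact add_mem (hv i) (hw i)
  smul_mem' c w hw i := by
    have : (φ ∘ (c • w)) = RatFunc.C c • (φ ∘ w) := by
      ext
      simp [Polynomial.smul_eq_C_mul]
    rw [this, Matrix.mulVec_smul, Pi.smul_apply, smul_eq_mul, mul_left_comm]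
    exact mul_mem (C_mem_proper c) (hw i)

/-- Reduction of the coordinates modulo the `δ i` is injective on the model: if `w = diag(δ) u`,
then `T⁻¹ w = U⁻¹ u` is both polynomial and strictly proper, hence zero. The target has dimension `∑
deg δ i`. -/
theorem finrank_polynomialModel_le {δ : ι → ℝ[X]} (hδ : ∀ i, δ i ≠ 0) {U : Matrix ι ι ℝ[X]}
    (hU : IsUnit U) :
    FiniteDimensional ℝ (polynomialModel (Matrix.diagonal δ * U)) ∧
      Module.finrank ℝ (polynomialModel (Matrix.diagonal δ * U)) ≤ (∏ i, δ i).natDegree := by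
  set T := Matrix.diagonal δ * U with hT
  obtain ⟨U', hU'⟩ := hU.exists_right_inv
  have hTu : IsUnit (T.map φ) := by
    rw [Matrix.isUnit_iff_isUnit_det, isUnit_iff_ne_zero, det_map_algebraMap, hT, Matrix.det_mul,
      Matrix.det_diagonal]
    exact RatFunc.algebraMap_ne_zero (mul_ne_zero (Finset.prod_ne_zero_iff.mpr fun i _ => hδ i)
      ((Matrix.isUnit_iff_isUnit_det _).mp hU).ne_zero)
  have hTu' := (Matrix.isUnit_iff_isUnit_det _).mp hTu
  let Φ : polynomialModel T →ₗ[ℝ] ∀ i, AdjoinRoot (δ i) :=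
    (LinearMap.pi fun i => (AdjoinRoot.mkₐ (R := ℝ) (δ i)).toLinearMap ∘ₗ LinearMap.proj i) ∘ₗ
      (polynomialModel T).subtype
  have hΦ : Function.Injective Φ := by
    rw [← LinearMap.ker_eq_bot, LinearMap.ker_eq_bot']
    rintro ⟨w, hw⟩ h0
    have hdvd : ∀ i, δ i ∣ w i := fun i => AdjoinRoot.mk_eq_zero.mp (congrFun h0 i)
    choose u hu using hdvd
    have hw1 : w = T.mulVec (U'.mulVec u) := by
      rw [Matrix.mulVec_mulVec, hT, Matrix.mul_assoc, hU', Matrix.mul_one]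
      ext1 i
      rw [Matrix.mulVec_diagonal, hu]
    have hw2 : (T.map φ)⁻¹.mulVec (φ ∘ w) = φ ∘ U'.mulVec u := by
      have : φ ∘ w = (T.map φ).mulVec (φ ∘ U'.mulVec u) := by
        rw [hw1]
        ext1 i
        exact RingHom.map_mulVec φ T _ i
      rw [this, Matrix.mulVec_mulVec, Matrix.nonsing_inv_mul _ hTu', Matrix.one_mulVec]
    have hw3 : U'.mulVec u = 0 := by
      ext1 i
      apply eq_zero_of_X_mul_mem_proper
      have := hw i
      rwa [hw2] at this
    have hw4 : w = 0 := by rw [hw1, hw3, Matrix.mulVec_zero]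
    exact Subtype.ext hw4
  have hfin : ∀ i, Module.Finite ℝ (AdjoinRoot (δ i)) := fun i =>
    (AdjoinRoot.powerBasis (hδ i)).finite
  refine ⟨Module.Finite.of_injective Φ hΦ, ?_⟩
  refine (LinearMap.finrank_le_finrank_of_injective hΦ).trans ?_
  rw [Module.finrank_pi_fintype, natDegree_prod _ _ fun i _ => hδ i]
  exact Finset.sum_le_sum fun i _ => by
    rw [(AdjoinRoot.powerBasis (hδ i)).finrank, AdjoinRoot.powerBasis_dim]

/-- The matrix of coordinates of polynomial vectors with respect to a basis of the polynomial
model. -/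
theorem exists_coordinates {T : Matrix ι ι ℝ[X]} {k : ℕ}
    (b : Module.Basis (Fin k) ℝ (polynomialModel T)) {τ : Type*} (P : Matrix ι τ ℝ[X])
    (hP : ∀ i j, RatFunc.X * ((T.map φ)⁻¹ * P.map φ) i j ∈ properFunctions) :
    ∃ A : Matrix (Fin k) τ ℝ,
      P = Matrix.of (fun i j => (b j : ι → ℝ[X]) i) * A.map Polynomial.C := by
  refine ⟨Matrix.of fun i j => b.repr ⟨fun l => P l j, fun l => hP l j⟩ i, ?_⟩
  ext l j : 1
  have h1 := congrFun (congrArg Subtype.val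
    (b.sum_repr ⟨fun l => P l j, fun l => hP l j⟩)) l
  rw [Matrix.mul_apply]
  simp only [Submodule.coe_sum, Submodule.coe_smul, Finset.sum_apply, Pi.smul_apply] at h1
  rw [← h1]
  refine Finset.sum_congr rfl fun i _ => ?_
  rw [Polynomial.smul_eq_C_mul, mul_comm]
  rfl

/-- A strictly proper rational matrix has a realization whose order is at most the degree of the
pole polynomial. -/
theorem exists_realization {G : Matrix ι κ (RatFunc ℝ)}
    (hG : ∀ i j, RatFunc.X * G i j ∈ properFunctions) :
    ∃ (k : ℕ) (A : Matrix (Fin k) (Fin k) ℝ) (B : Matrix (Fin k) κ ℝ) (C : Matrix ι (Fin k) ℝ),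
      k ≤ (polePolynomial G).natDegree ∧ transferMatrix A B C 0 = G := by
  obtain ⟨δ, U, N, -, -, hδ0, hδ, hU, hN, -⟩ := (smithMcMillan G).exists_left_coprime
  obtain ⟨hfin, hle⟩ := finrank_polynomialModel_le hδ0 hU
  have hTu : IsUnit ((Matrix.diagonal δ * U).map φ).det := by
    rw [isUnit_iff_ne_zero, det_map_algebraMap, Matrix.det_mul, Matrix.det_diagonal]
    exact RatFunc.algebraMap_ne_zero (mul_ne_zero (Finset.prod_ne_zero_iff.mpr fun i _ => hδ0 i)
      ((Matrix.isUnit_iff_isUnit_det _).mp hU).ne_zero)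
  rw [hδ] at hle
  generalize Matrix.diagonal δ * U = T at *
  let b := Module.finBasis ℝ (polynomialModel T)
  set Wm := Matrix.of fun i j => (b j : ι → ℝ[X]) i
  set Vm := (T.map φ)⁻¹ * Wm.map φ with hVm
  have hVproper : ∀ i j, RatFunc.X * Vm i j ∈ properFunctions := fun i j => (b j).2 i
  -- The output matrix is the value of `λ T⁻¹ Wm` at infinity. Subtracting `T c` from `λ Wm`
  -- therefore returns to the model, and the coordinates of the result form the state matrix.
  choose c hc using fun i j => exists_value_at_infinity (hVproper i j)
  have hshift : (T.map φ)⁻¹ * ((X : ℝ[X]) • Wm - T * (Matrix.of c).map Polynomial.C).map φ =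
      (RatFunc.X : RatFunc ℝ) • Vm - (Matrix.of c).map RatFunc.C := by
    rw [Matrix.map_sub _ (map_sub _), map_algebraMap_mul, map_map_C,
      map_algebraMap_smul, RatFunc.algebraMap_X, Matrix.mul_sub, Matrix.mul_smul,
      ← Matrix.mul_assoc, Matrix.nonsing_inv_mul _ hTu, Matrix.one_mul]
  obtain ⟨A, hA⟩ := exists_coordinates b ((X : ℝ[X]) • Wm - T * (Matrix.of c).map Polynomial.C) (by
    intro i j
    rw [hshift]
    exact hc i j)
  obtain ⟨B, hB⟩ := exists_coordinates b N (by
    intro i j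
    rw [← hN, ← Matrix.mul_assoc, Matrix.nonsing_inv_mul _ hTu, Matrix.one_mul]
    exact hG i j)
  refine ⟨_, A, B, Matrix.of c, hle, ?_⟩
  -- Thus `C (λI - A)⁻¹ = T⁻¹ Wm`, and `Wm B = N` turns the transfer matrix into `T⁻¹ N = G`.
  have hA' : Vm * A.charmatrix.map φ = (Matrix.of c).map RatFunc.C := by
    rw [hA, map_algebraMap_mul, map_map_C, ← Matrix.mul_assoc, ← hVm] at hshift
    rw [charmatrix_map_algebraMap, Matrix.mul_sub, hshift, Matrix.mul_smul, Matrix.mul_one,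
      sub_sub_cancel]
  have hAu := (Matrix.isUnit_iff_isUnit_det _).mp (isUnit_charmatrix_map A)
  rw [transferMatrix_zero, ← hA', Matrix.mul_assoc Vm, Matrix.mul_nonsing_inv _ hAu,
    Matrix.mul_one, hVm, Matrix.mul_assoc, ← map_map_C, ← map_algebraMap_mul, ← hB, ← hN,
    ← Matrix.mul_assoc, Matrix.nonsing_inv_mul _ hTu, Matrix.one_mul]

end Realization

/-! ### Poles and zeros of real-rational matrices -/

section PolesZeros

variable {ι κ : Type*} [Fintype ι] [Fintype κ] [DecidableEq ι] [DecidableEq κ]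

theorem rootMultiplicity_map_eq_zero_iff {a : ℝ[X]} (ha : a ≠ 0) (z : ℂ) :
    ¬ 0 < (a.map (algebraMap ℝ ℂ)).rootMultiplicity z ↔ aeval z a ≠ 0 := by
  rw [rootMultiplicity_pos (Polynomial.map_ne_zero ha), IsRoot.def, eval_map_algebraMap]

theorem rootMultiplicity_zero_eq_zero_iff {a : ℝ[X]} (ha : a ≠ 0) :
    ¬ 0 < a.rootMultiplicity 0 ↔ aeval (0 : ℂ) a ≠ 0 := by
  rw [rootMultiplicity_pos ha, IsRoot.def, aeval_zero_ne_zero_iff, coeff_zero_eq_eval_zero]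

theorem not_isPole_coe_iff (G : Matrix ι κ (RatFunc ℝ)) (z : ℂ) :
    ¬ IsPole G (z : OnePoint ℂ) ↔ ∀ i j, G i j ∈ regularAt z :=
  (rootMultiplicity_map_eq_zero_iff (polePolynomial_ne_zero G) z).trans
    (aeval_polePolynomial_ne_zero_iff G z)

theorem isProper_iff (G : Matrix ι κ (RatFunc ℝ)) :
    IsProper G ↔ ∀ i j, G i j ∈ properFunctions := by
  refine ((rootMultiplicity_zero_eq_zero_iff (polePolynomial_ne_zero (atInverse G))).trans
    (aeval_polePolynomial_ne_zero_iff _ 0)).trans ?_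
  simp [atInverse_eq_map, properFunctions]

theorem zeroPolynomial_ne_zero (G : Matrix ι κ (RatFunc ℝ)) : zeroPolynomial G ≠ 0 :=
  Finset.prod_ne_zero_iff.mpr fun k _ => (smithMcMillan G).num_ne_zero k

theorem not_isZero_coe {G : Matrix ι κ (RatFunc ℝ)} {K : Matrix κ ι (RatFunc ℝ)} {z : ℂ}
    (h : G * K = 1) (hK : ∀ i j, K i j ∈ regularAt z) : ¬ IsZero G (z : OnePoint ℂ) :=
  (rootMultiplicity_map_eq_zero_iff (zeroPolynomial_ne_zero G) z).mpr
    (aeval_zeroPolynomial_ne_zero h hK)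

theorem not_isZero_infty {G : Matrix ι κ (RatFunc ℝ)} {K : Matrix κ ι (RatFunc ℝ)}
    (h : G * K = 1) (hK : ∀ i j, K i j ∈ properFunctions) : ¬ IsZero G OnePoint.infty := by
  refine (rootMultiplicity_zero_eq_zero_iff (zeroPolynomial_ne_zero (atInverse G))).mpr
    (aeval_zeroPolynomial_ne_zero (K := K.map invSubst) ?_ hK)
  rw [atInverse_eq_map, ← Matrix.map_mul, h, Matrix.map_one _ (map_zero _) (map_one _)]

/-- Over `ℂ` the pole polynomial splits, so its degree sums the degrees of the finite poles; the
McMillan degree adds the one at infinity. -/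
theorem natDegree_polePolynomial_le (G : Matrix ι κ (RatFunc ℝ)) :
    (polePolynomial G).natDegree ≤ mcMillanDegree G := by
  set a := (polePolynomial G).map (algebraMap ℝ ℂ)
  have ha : a ≠ 0 := Polynomial.map_ne_zero (polePolynomial_ne_zero G)
  have hdeg : (polePolynomial G).natDegree = ∑ z ∈ a.roots.toFinset, a.rootMultiplicity z := by
    rw [← natDegree_map (algebraMap ℝ ℂ) (p := polePolynomial G),
      (IsAlgClosed.splits a).natDegree_eq_card_roots, ← Multiset.toFinset_sum_count_eq]
    exact Finset.sum_congr rfl fun z _ => count_roots a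
  classical
  let e : ℂ ↪ OnePoint ℂ := ⟨(↑), OnePoint.coe_injective⟩
  -- A `finsum` with infinite support is `0` by default, so finiteness of the set of poles is
  -- essential.
  have hsupp : Function.support (poleDegree G) ⊆
      ((insert (OnePoint.infty : OnePoint ℂ) (a.roots.toFinset.map e) : Finset (OnePoint ℂ)) :
        Set (OnePoint ℂ)) := by
    intro z hz
    induction z using OnePoint.rec with
    | infty => simp
    | coe z =>
      have hz' : a.IsRoot z := (rootMultiplicity_pos ha).mp (Nat.pos_of_ne_zero hz)
      rw [Finset.coe_insert, Finset.coe_map]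
      exact Or.inr ⟨z, by simpa using ⟨ha, hz'⟩, rfl⟩
  rw [mcMillanDegree, finsum_eq_sum_of_support_subset _ hsupp, hdeg]
  refine le_trans ?_ (Finset.sum_le_sum_of_subset (Finset.subset_insert _ _))
  rw [Finset.sum_map]
  exact le_rfl

theorem poleDegree_le_of_dvd {τ υ : Type*} [Fintype τ] [Fintype υ] [DecidableEq τ]
    [DecidableEq υ] {G : Matrix ι κ (RatFunc ℝ)} {H : Matrix τ υ (RatFunc ℝ)} (hH : IsProper H)
    (h : polePolynomial H ∣ polePolynomial G) (z : OnePoint ℂ) :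
    poleDegree H z ≤ poleDegree G z := by
  induction z using OnePoint.rec with
  | infty => exact (Nat.eq_zero_of_not_pos hH).le.trans (Nat.zero_le _)
  | coe z =>
    exact rootMultiplicity_le_rootMultiplicity_of_dvd
      (Polynomial.map_ne_zero (polePolynomial_ne_zero G)) (Polynomial.map_dvd _ h) z

end PolesZeros

/-! ### System response-type realizations -/

section SystemResponse

variable {p q m : ℕ}

theorem lambdaSub_eq_X_smul (W : Matrix (Fin p) (Fin p) (RatFunc ℝ)) :
    lambdaSub W = (RatFunc.X : RatFunc ℝ) • (1 - (RatFunc.X : RatFunc ℝ)⁻¹ • W) := by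
  rw [smul_sub, smul_smul, mul_inv_cancel₀ RatFunc.X_ne_zero, one_smul, lambdaSub]

theorem isUnit_det_lambdaSub {W : Matrix (Fin p) (Fin p) (RatFunc ℝ)} (hW : IsProper W) :
    IsUnit (lambdaSub W).det := by
  obtain ⟨-, -, -, h, -⟩ := exists_proper_inverse ((isProper_iff W).mp hW)
  rw [isUnit_iff_ne_zero, lambdaSub_eq_X_smul, Matrix.det_smul]
  exact mul_ne_zero (pow_ne_zero _ RatFunc.X_ne_zero) h

/-- Multiplication by `λ I - W`, with `W` proper, raises the degree of the determinant by at most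
the size of `W`. -/
theorem natDegree_det_le_of_eq_mul_lambdaSub {W : Matrix (Fin p) (Fin p) (RatFunc ℝ)}
    (hW : IsProper W) {P T : Matrix (Fin p) (Fin p) ℝ[X]}
    (h : P.map φ = T.map φ * lambdaSub W) : P.det.natDegree ≤ T.det.natDegree + p := by
  obtain ⟨-, -, -, -, hdet⟩ := exists_proper_inverse ((isProper_iff W).mp hW)
  obtain ⟨a, b, hb, hab, hle⟩ := exists_natDegree_le_of_proper hdet
  by_cases hP : P.det = 0
  · simp [hP]
  -- Here `det(λI - W) = λ^p det(1 - λ⁻¹W)`, and the last determinant is the proper fraction `a/b`.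
  have h1 : P.det * b = T.det * X ^ p * a := by
    apply IsFractionRing.injective ℝ[X] (RatFunc ℝ)
    rw [map_mul, ← det_map_algebraMap, h, Matrix.det_mul, lambdaSub_eq_X_smul, Matrix.det_smul,
      Fintype.card_fin, det_map_algebraMap, map_mul, map_mul, map_pow, RatFunc.algebraMap_X, ← hab]
    ring
  have h2 := congrArg natDegree h1
  rw [natDegree_mul hP hb] at h2
  have h3 : (T.det * X ^ p * a).natDegree ≤ T.det.natDegree + p + a.natDegree :=
    natDegree_mul_le.trans (Nat.add_le_add_right (natDegree_mul_le.trans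
      (Nat.add_le_add_left (natDegree_X_pow_le p) _)) _)
  omega

/-- For a minimal system, `[λ I - W  V]` has a polynomial right inverse. -/
theorem IsSRTR.exists_right_inverse {A : Matrix (Fin p ⊕ Fin q) (Fin p ⊕ Fin q) ℝ}
    {B : Matrix (Fin p ⊕ Fin q) (Fin m) ℝ} {W : Matrix (Fin p) (Fin p) (RatFunc ℝ)}
    {V : Matrix (Fin p) (Fin m) (RatFunc ℝ)} (hWV : IsSRTR A B W V)
    (hmin : IsMinimalRealization A B (outputMatrix p q) 0) :
    ∃ K : Matrix (Fin p ⊕ Fin m) (Fin p) ℝ[X],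
      Matrix.fromCols (lambdaSub W) V * K.map φ = 1 := by
  set G := systemTFM A B with hG
  obtain ⟨T, N, -, -, hN, -, hT⟩ := exists_left_coprime (Matrix.fromCols W V)
  obtain ⟨T₀, N₀, Y, Z, hN₀, hYZ, hT₀⟩ := exists_left_coprime G
  have hL := isUnit_det_lambdaSub hWV.proper_W
  have hLG : lambdaSub W * G = V := by
    rw [hG, hWV.eq, ← Matrix.mul_assoc, Matrix.mul_nonsing_inv _ hL, Matrix.one_mul]
  have hTW : T.map φ * W = N.toCols₁.map φ := by
    rw [Matrix.mul_fromCols] at hN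
    ext i j : 1
    exact congrFun (congrFun hN i) (Sum.inl j)
  have hTV : T.map φ * V = N.toCols₂.map φ := by
    rw [Matrix.mul_fromCols] at hN
    ext i j : 1
    exact congrFun (congrFun hN i) (Sum.inr j)
  set P : Matrix (Fin p) (Fin p) ℝ[X] := (X : ℝ[X]) • T - N.toCols₁ with hP
  have hPL : P.map φ = T.map φ * lambdaSub W := by
    rw [hP, Matrix.map_sub _ (map_sub _), map_algebraMap_smul, ← hTW, lambdaSub, Matrix.mul_sub,
      Matrix.mul_smul, Matrix.mul_one, RatFunc.algebraMap_X]
  have hPG : P.map φ * G = N.toCols₂.map φ := by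
    rw [hPL, Matrix.mul_assoc, hLG, hTV]
  have hTu : IsUnit (T.map φ).det := by
    rw [isUnit_iff_ne_zero, det_map_algebraMap]
    exact RatFunc.algebraMap_ne_zero (hT.ne_zero_iff.mpr (polePolynomial_ne_zero _))
  have hPdet : P.det ≠ 0 := by
    intro h0
    have h1 := hTu.mul hL
    rw [← Matrix.det_mul, ← hPL, det_map_algebraMap, h0, map_zero] at h1
    exact not_isUnit_zero h1
  have hPdeg : P.det.natDegree ≤ p + q := by
    have h1 := natDegree_det_le_of_eq_mul_lambdaSub hWV.proper_W hPL
    have h2 := (natDegree_eq_of_degree_eq (degree_eq_degree_of_associated hT)).trans_le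
      ((natDegree_polePolynomial_le _).trans hWV.degree_le)
    omega
  -- The only use of minimality: a smaller pole polynomial would give a realization of order below
  -- `p + q`.
  have hT₀deg : p + q ≤ T₀.det.natDegree := by
    obtain ⟨k, A', B', C', hk, hreal⟩ := exists_realization (G := G)
      (transferMatrix_strictly_proper A B _)
    have h1 := hmin k A' B' C' 0 (hreal.trans hG)
    rw [Fintype.card_sum, Fintype.card_fin, Fintype.card_fin] at h1
    rw [natDegree_eq_of_degree_eq (degree_eq_degree_of_associated hT₀)]
    exact h1.trans hk
  -- Because `N₂ = P G`, this is `P (Y + G Z) = P T₀⁻¹`.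
  set Q := P * Y + N.toCols₂ * Z with hQ
  have hQT : P = Q * T₀ := by
    have h1 : T₀.map φ * (Y.map φ + G * Z.map φ) = 1 := by
      rw [Matrix.mul_add, ← Matrix.mul_assoc, hN₀, ← map_algebraMap_mul, ← map_algebraMap_mul,
        ← Matrix.map_add _ (map_add _), hYZ, map_algebraMap_one]
    apply map_algebraMap_injective
    rw [hQ, map_algebraMap_mul, Matrix.map_add _ (map_add _), map_algebraMap_mul,
      map_algebraMap_mul, ← hPG, Matrix.mul_assoc (P.map φ) G, ← Matrix.mul_add,
      Matrix.mul_assoc, mul_eq_one_comm.mp h1, Matrix.mul_one]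
  -- `deg det Q + deg det T₀ = deg det P ≤ p + q ≤ deg det T₀` forces `det Q` to be constant.
  have hQu : IsUnit Q := by
    rw [Matrix.isUnit_iff_isUnit_det]
    have h1 := congrArg Matrix.det hQT
    rw [Matrix.det_mul] at h1
    have h2 : Q.det ≠ 0 := fun h0 => hPdet (by rw [h1, h0, zero_mul])
    have h3 : T₀.det ≠ 0 := fun h0 => hPdet (by rw [h1, h0, mul_zero])
    rw [h1, natDegree_mul h2 h3] at hPdeg
    rw [Polynomial.isUnit_iff_degree_eq_zero, degree_eq_natDegree h2]
    have : Q.det.natDegree = 0 := by omega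
    rw [this]
    rfl
  obtain ⟨Q', hQ'⟩ := hQu.exists_right_inv
  -- From `T [λI - W V] = [P N₂]` and `[P N₂] [Y; Z] = Q`, this product is a right inverse after
  -- cancelling `T` on the left.
  refine ⟨Matrix.fromRows Y Z * (Q' * T), ?_⟩
  have h1 : T.map φ * Matrix.fromCols (lambdaSub W) V = (Matrix.fromCols P N.toCols₂).map φ := by
    rw [Matrix.mul_fromCols, ← hPL, hTV, Matrix.fromCols_map]
  have h2 : T.map φ * (Matrix.fromCols (lambdaSub W) V *
      (Matrix.fromRows Y Z * (Q' * T)).map φ) = T.map φ * 1 := by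
    rw [← Matrix.mul_assoc, h1, ← map_algebraMap_mul, ← Matrix.mul_assoc,
      Matrix.fromCols_mul_fromRows, ← hQ, ← Matrix.mul_assoc, hQ', Matrix.one_mul, Matrix.mul_one]
  have h3 := congrArg (fun H => (T.map φ)⁻¹ * H) h2
  simpa only [← Matrix.mul_assoc, Matrix.nonsing_inv_mul _ hTu, Matrix.one_mul] using h3

/-- If `B` and `C` are square and invertible, `C (λ I - A)⁻¹ B` is the inverse of a polynomial
matrix of degree at most one. -/
theorem exists_polynomial_inverse (A : Matrix (Fin p) (Fin p) ℝ) {B C : Matrix (Fin p) (Fin p) ℝ}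
    (hB : IsUnit B) (hC : IsUnit C) :
    ∃ P : Matrix (Fin p) (Fin p) ℝ[X], transferMatrix A B C 0 * P.map φ = 1 ∧
      ∀ i j, ((RatFunc.X : RatFunc ℝ)⁻¹ • P.map φ) i j ∈ properFunctions := by
  obtain ⟨B', hB'⟩ := hB.exists_right_inv
  obtain ⟨C', hC'⟩ := hC.exists_right_inv
  have hone : ∀ D E : Matrix (Fin p) (Fin p) ℝ, D * E = 1 →
      D.map RatFunc.C * E.map RatFunc.C = 1 := by
    intro D E h
    rw [← Matrix.map_mul, h, Matrix.map_one _ (map_zero _) (map_one _)]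
  have hAu := (Matrix.isUnit_iff_isUnit_det _).mp (isUnit_charmatrix_map A)
  -- The inverse is `B⁻¹ (λI - A) C⁻¹`.
  refine ⟨B'.map Polynomial.C * A.charmatrix * C'.map Polynomial.C, ?_, ?_⟩ <;>
    rw [map_algebraMap_mul, map_algebraMap_mul, map_map_C, map_map_C]
  · rw [transferMatrix_zero]
    calc _ = C.map RatFunc.C * ((A.charmatrix.map φ)⁻¹ * ((B.map RatFunc.C * B'.map RatFunc.C) *
          A.charmatrix.map φ)) * C'.map RatFunc.C := by simp only [Matrix.mul_assoc]
      _ = 1 := by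
        rw [hone _ _ hB', Matrix.one_mul, Matrix.nonsing_inv_mul _ hAu, Matrix.mul_one, hone _ _ hC']
  · have hchar : ∀ i j, ((RatFunc.X : RatFunc ℝ)⁻¹ • A.charmatrix.map φ) i j ∈
        properFunctions := by
      intro i j
      rw [charmatrix_map_algebraMap, smul_sub, smul_smul, inv_mul_cancel₀ RatFunc.X_ne_zero,
        one_smul]
      refine sub_mem ?_ (mul_mem X_inv_mem_proper (C_mem_proper (A i j)))
      rw [Matrix.one_apply]
      split_ifs
      · exact one_mem _
      · exact zero_mem _
    rw [← Matrix.smul_mul, ← Matrix.mul_smul]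
    exact mul_entries_mem _ (mul_entries_mem _ (fun _ _ => C_mem_proper _) hchar)
      (fun _ _ => C_mem_proper _)

/-- The resolvent is the adjugate over the characteristic polynomial, whose complex roots are the
eigenvalues of `A`. -/
theorem transferMatrix_regularAt {A B C : Matrix (Fin p) (Fin p) ℝ} {S : Set ℂ}
    (hA : EigenvaluesIn S A) {z : ℂ} (hz : z ∉ S) (i j : Fin p) :
    transferMatrix A B C 0 i j ∈ regularAt z := by
  have hchar : aeval z A.charpoly ≠ 0 := by
    intro h0
    apply hz
    apply hA
    rw [Matrix.mem_spectrum_iff_isRoot_charpoly, Matrix.charpoly_map, IsRoot.def,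
      eval_map_algebraMap, h0]
  have hinv : ∀ i j, (A.charmatrix.map φ)⁻¹ i j ∈ regularAt z := by
    intro i j
    have h1 : (A.charmatrix.map φ)⁻¹ = (φ A.charpoly)⁻¹ • A.charmatrix.adjugate.map φ := by
      apply Matrix.inv_eq_right_inv
      rw [Matrix.mul_smul, ← map_algebraMap_mul, Matrix.mul_adjugate, map_algebraMap_smul,
        map_algebraMap_one, smul_smul]
      rw [← Matrix.charpoly, inv_mul_cancel₀
        (RatFunc.algebraMap_ne_zero A.charpoly_monic.ne_zero), one_smul]
    rw [h1]
    exact mul_mem (inv_algebraMap_mem_regularAt hchar) (algebraMap_mem_regularAt z _)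
  rw [transferMatrix_zero]
  exact mul_entries_mem _ (mul_entries_mem _ (fun _ _ => C_mem_regularAt z _) hinv)
    (fun _ _ => C_mem_regularAt z _) i j

theorem lambdaSub_mem (S : Subring (RatFunc ℝ))
    (hX : RatFunc.X ∈ S) {W : Matrix (Fin p) (Fin p) (RatFunc ℝ)}
    (hW : ∀ i j, W i j ∈ S) (i j : Fin p) : lambdaSub W i j ∈ S := by
  refine sub_mem (mul_mem hX ?_) (hW i j)
  rw [Matrix.one_apply]
  split_ifs
  · exact one_mem S
  · exact zero_mem S

end SystemResponse

theorem theorem4p2 (t : TimeDomain) {p q m : ℕ}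
    (A : Matrix (Fin p ⊕ Fin q) (Fin p ⊕ Fin q) ℝ) (B : Matrix (Fin p ⊕ Fin q) (Fin m) ℝ)
    (hmin : IsMinimalRealization A B (outputMatrix p q) 0)
    (W : Matrix (Fin p) (Fin p) (RatFunc ℝ)) (V : Matrix (Fin p) (Fin m) (RatFunc ℝ))
    (hWV : IsSRTR A B W V) (hstable : IsStable (stabilityDomain t) (Matrix.fromCols W V))
    (Ax Bx Cx : Matrix (Fin p) (Fin p) ℝ) (hAx : EigenvaluesIn (stabilityDomain t) Ax)
    (hBx : IsUnit Bx) (hCx : IsUnit Cx)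
    (Θ : Matrix (Fin p) (Fin p) (RatFunc ℝ)) (hΘ : Θ = transferMatrix Ax Bx Cx 0)
    (M : Matrix (Fin p) (Fin p) (RatFunc ℝ)) (N : Matrix (Fin p) (Fin m) (RatFunc ℝ))
    (hMN : Matrix.fromCols M N = Θ * Matrix.fromCols (lambdaSub W) V) :
    IsLCF (stabilityDomain t) (systemTFM A B) M N ∧
      ∀ z : OnePoint ℂ,
        poleDegree (Matrix.fromCols W V) z ≤ poleDegree (Matrix.fromCols M N) z ∧
        poleDegree W z ≤ poleDegree M z ∧ poleDegree V z ≤ poleDegree N z := by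
  obtain ⟨hM, hN⟩ : M = Θ * lambdaSub W ∧ N = Θ * V := by
    rw [Matrix.mul_fromCols] at hMN
    exact Matrix.fromCols_inj.eq_iff.mp hMN
  obtain ⟨P, hP, hXinvP⟩ := exists_polynomial_inverse Ax hBx hCx
  rw [← hΘ] at hP
  have hP' : P.map φ * Θ = 1 := mul_eq_one_comm.mp hP
  obtain ⟨R, hR⟩ := hWV.exists_right_inverse hmin
  have hWp := (isProper_iff W).mp hWV.proper_W
  have hVp := (isProper_iff V).mp hWV.proper_V
  have hWVp : ∀ i j, Matrix.fromCols W V i j ∈ properFunctions := by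
    rintro i (j | j)
    · exact hWp i j
    · exact hVp i j
  have hL := isUnit_det_lambdaSub hWV.proper_W
  have hΘu : IsUnit Θ.det := (Matrix.isUnit_iff_isUnit_det _).mp (IsUnit.of_mul_eq_one _ hP)
  have hright : Matrix.fromCols M N * (R * P).map φ = 1 := by
    rw [hMN, map_algebraMap_mul, Matrix.mul_assoc, ← Matrix.mul_assoc _ (R.map φ), hR,
      Matrix.one_mul, hP]
  have hΘp : ∀ i j, RatFunc.X * Θ i j ∈ properFunctions := by
    rw [hΘ]
    exact transferMatrix_strictly_proper Ax Bx Cx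
  have hΘp' : ∀ i j, Θ i j ∈ properFunctions := by
    intro i j
    have h := mul_mem X_inv_mem_proper (hΘp i j)
    rwa [← mul_assoc, inv_mul_cancel₀ RatFunc.X_ne_zero, one_mul] at h
  have hMp : ∀ i j, M i j ∈ properFunctions := by
    -- Strict properness of `Θ` absorbs the factor `λ`.
    have h : M = ((RatFunc.X : RatFunc ℝ) • Θ) - Θ * W := by
      rw [hM, lambdaSub, Matrix.mul_sub, Matrix.mul_smul, Matrix.mul_one]
    intro i j
    rw [h]
    exact sub_mem (hΘp i j) (mul_entries_mem _ hΘp' hWp i j)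
  have hinv : ∃ K : Matrix (Fin p) (Fin p) (RatFunc ℝ), M * K = 1 ∧
      ∀ i j, K i j ∈ properFunctions := by
    obtain ⟨K, hK, hK1, -⟩ := exists_proper_inverse hWp
    refine ⟨K * ((RatFunc.X : RatFunc ℝ)⁻¹ • P.map φ), ?_, mul_entries_mem _ hK hXinvP⟩
    rw [hM, lambdaSub_eq_X_smul, Matrix.mul_smul, Matrix.smul_mul, Matrix.mul_smul,
      Matrix.mul_smul, smul_smul, mul_inv_cancel₀ RatFunc.X_ne_zero, one_smul, Matrix.mul_assoc,
      ← Matrix.mul_assoc _ K, hK1, Matrix.one_mul, hP]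
  refine ⟨⟨?_, ?_, ?_, ?_, ?_⟩, fun z => ⟨?_, ?_, ?_⟩⟩
  · rw [Matrix.isUnit_iff_isUnit_det, hM, Matrix.det_mul]
    exact hΘu.mul hL
  · rw [hWV.eq, hM, hN, Matrix.mul_inv_rev, Matrix.mul_assoc, ← Matrix.mul_assoc Θ⁻¹,
      Matrix.nonsing_inv_mul _ hΘu, Matrix.one_mul]
  · apply le_antisymm
    · simpa using Matrix.rank_le_card_height (Matrix.fromCols M N)
    · have h := Matrix.rank_mul_le_left (Matrix.fromCols M N) ((R * P).map φ)
      rwa [hright, Matrix.rank_one, Fintype.card_fin] at h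
  · intro z hz
    induction z using OnePoint.rec with
    | infty =>
      refine (isProper_iff _).mpr ?_
      rintro i (j | j)
      · exact hMp i j
      · rw [Matrix.fromCols_apply_inr, hN]
        exact mul_entries_mem _ hΘp' hVp i j
    | coe z =>
      have hzS : z ∉ stabilityDomain t := fun h => hz ⟨z, h, rfl⟩
      have hreg := (not_isPole_coe_iff _ _).mp (hstable z hz)
      rw [not_isPole_coe_iff, hMN, hΘ]
      refine mul_entries_mem _ (transferMatrix_regularAt hAx hzS) ?_
      rintro i (j | j)
      · refine lambdaSub_mem _ ?_ (fun i j => hreg i (Sum.inl j)) i j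
        simpa using algebraMap_mem_regularAt z X
      · exact hreg i (Sum.inr j)
  · intro z _
    induction z using OnePoint.rec with
    | infty =>
      obtain ⟨K, hK1, hK⟩ := hinv
      -- The polynomial right inverse need not be proper, so at infinity the proper inverse of `M`,
      -- padded by zero rows, replaces it.
      refine not_isZero_infty (K := Matrix.fromRows K 0) ?_ ?_
      · rw [Matrix.fromCols_mul_fromRows, hK1, Matrix.mul_zero, add_zero]
      · rintro (i | i) j
        · exact hK i j
        · exact zero_mem _
    | coe z => exact not_isZero_coe hright fun i j => algebraMap_mem_regularAt z _
  · refine poleDegree_le_of_dvd ((isProper_iff _).mpr hWVp) ?_ z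
    -- The sign matrix `J` reconciles the two blocks: `[W V] J = [W -V] = -Θ⁻¹ [M N] + [λI 0]`.
    refine polePolynomial_dvd_of_eq (P := -P)
      (J := Matrix.fromBlocks (1 : Matrix (Fin p) (Fin p) ℝ[X]) 0 0
      (-1 : Matrix (Fin m) (Fin m) ℝ[X])) (E := Matrix.fromCols ((X : ℝ[X]) • 1) 0) ?_ ?_
    · rw [Matrix.isUnit_iff_isUnit_det, Matrix.det_fromBlocks_zero₁₂, Matrix.det_one, one_mul]
      exact (Matrix.isUnit_iff_isUnit_det _).mp isUnit_one.neg
    · rw [hMN, Matrix.map_neg _ (map_neg _), ← Matrix.mul_assoc, Matrix.neg_mul, hP',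
        Matrix.fromBlocks_map, Matrix.fromCols_mul_fromBlocks, Matrix.neg_mul, Matrix.one_mul,
        Matrix.fromCols_map]
      ext i (j | j) : 2
      · simp [lambdaSub, Matrix.one_apply, apply_ite φ]
      · simp [Matrix.map_neg _ (map_neg φ)]
  · refine poleDegree_le_of_dvd hWV.proper_W ?_ z
    refine polePolynomial_dvd_of_eq (P := -P) (J := 1) (E := (X : ℝ[X]) • 1) isUnit_one ?_
    rw [hM, map_algebraMap_one, Matrix.mul_one, Matrix.map_neg _ (map_neg _), ← Matrix.mul_assoc,
      Matrix.neg_mul, hP', Matrix.neg_mul, Matrix.one_mul, map_algebraMap_smul, map_algebraMap_one,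
      RatFunc.algebraMap_X, lambdaSub]
    abel
  · refine poleDegree_le_of_dvd hWV.proper_V ?_ z
    refine polePolynomial_dvd_of_eq (P := P) (J := 1) (E := 0) isUnit_one ?_
    rw [hN, map_algebraMap_one, Matrix.mul_one, ← Matrix.mul_assoc, hP', Matrix.one_mul,
      Matrix.map_zero _ (map_zero _), add_zero]
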